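/- **Definitions.** Let $X\subseteq\{0,1\}^n$ and let $f\colon X\to\{0,1\}$ be a partial Boolean function on $n$ bits. A (deterministic) decision tree queries input bits adaptively and outputs a bit; $\mathrm{cost}(D(x))$ is the number of queries that the tree $D$ makes on input $x$. A randomized algorithm $R$ is a probability distribution over decision trees. For a success probability $\gamma\in[0,1]$, the *average-case query complexity* of $f$ is $$\overline{\mathrm R}_\gamma(f)=\min_{R}\ \max_{x\in X}\ \mathbb E_{D\sim R}[\mathrm{cost}(D(x))],$$ where the minimum is over all $R$ with $\Pr_{D\sim R}[D(x)=f(x)]\ge\gamma$ for every $x\in X$. The *maximum distributional query complexity* of $f$ is $$\overline{\overline{\mathrm R}}_\gamma(f)=\max_{\mu}\ \min_{R}\ \mathbb E_{x\sim\mu,\,D\sim R}[\mathrm{cost}(D(x))],$$ where $\mu$ ranges over the probability distributions on $X$ and, for given $\mu$, the minimum is over all $R$ with $\Pr_{x\sim\mu,\,D\sim R}[D(x)=f(x)]\ge\gamma$. **Proposition (separation of maximum distributional and average-case complexity).** There are absolute constants $C,c>0$ such that for every $n\ge 1$ and every $\delta$ with $n^{-c}\le\delta\le 1$ there are a set $X\subseteq\{0,1\}^n$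 and a non-constant partial function $f\colon X\to\{0,1\}$ with $$\overline{\overline{\mathrm R}}_{\frac{1+\delta}{2}}(f)\ \le\ C\,\delta^{1/6}\;\overline{\mathrm R}_{\frac{1+\delta}{2}}(f).$$ In particular, for every fixed $\delta\in(0,1]$, and for every $\delta=\delta(n)\in(0,1]$ that vanishes at most as fast as $n^{-c}$, such an $f$ exists for infinitely many (indeed all sufficiently large) $n$, so that in the small-advantage regime the maximum distributional complexity can be smaller than the average-case complexity by a polynomial factor in $\delta$. -/

import Mathlib

open scoped ENNReal

/-- Deterministic query algorithms on `n`-bit inputs: a leaf carries the output bit, and an internal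
node queries one coordinate and continues in its first subtree if the bit read is `false` (`0`), in
its second subtree if it is `true` (`1`). -/
inductive DecisionTree (n : ℕ) : Type
  | leaf (b : Bool) : DecisionTree n
  | query (i : Fin n) (t₀ t₁ : DecisionTree n) : DecisionTree n

namespace DecisionTree

/-- The output of the tree on input `x`. -/
def eval {n : ℕ} : DecisionTree n → (Fin n → Bool) → Bool
  | leaf b, _ => b
  | query i t₀ t₁, x => if x i then t₁.eval x else t₀.eval x

/-- The cost on input `x`: the depth of the leaf reached by `x`, i.e. the number of queries made. -/
def cost {n : ℕ} : DecisionTree n → (Fin n → Bool) → ℕ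
  | leaf _, _ => 0
  | query i t₀ t₁, x => (if x i then t₁.cost x else t₀.cost x) + 1

end DecisionTree

/-- A randomized query algorithm is a probability distribution over decision trees. -/
abbrev RandomizedAlgorithm (n : ℕ) : Type := PMF (DecisionTree n)

namespace RandomizedAlgorithm

variable {n : ℕ}

/-- The probability, over the randomness of `R`, that `R` outputs `b` on input `x`. -/
noncomputable def outputProb (R : RandomizedAlgorithm n) (x : Fin n → Bool) (b : Bool) : ℝ≥0∞ :=
  ∑' D : DecisionTree n, R D * (if D.eval x = b then 1 else 0)

/-- The expected number of queries, over the randomness of `R`, that `R` makes on input `x`. -/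
noncomputable def expectedCost (R : RandomizedAlgorithm n) (x : Fin n → Bool) : ℝ≥0∞ :=
  ∑' D : DecisionTree n, R D * (D.cost x : ℝ≥0∞)

variable {X : Set (Fin n → Bool)}

/-- `min_{x ∈ X} Pr_{D ∼ R}[D(x) = f(x)]`, for a partial function `f` with domain `X`. -/
noncomputable def worstSuccess (R : RandomizedAlgorithm n) (f : X → Bool) : ℝ≥0∞ :=
  ⨅ x : X, R.outputProb x (f x)

/-- `max_{x ∈ X} E_{D ∼ R}[cost(D(x))]`. -/
noncomputable def worstExpectedCost (R : RandomizedAlgorithm n) (X : Set (Fin n → Bool)) : ℝ≥0∞ :=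
  ⨆ x : X, R.expectedCost x

/-- `Pr_{x ∼ μ, D ∼ R}[D(x) = f(x)]`, for a distribution `μ` on the domain `X` of `f`. -/
noncomputable def distSuccess (R : RandomizedAlgorithm n) (f : X → Bool) (μ : PMF X) : ℝ≥0∞ :=
  ∑' x : X, μ x * R.outputProb x (f x)

/-- `E_{x ∼ μ, D ∼ R}[cost(D(x))]`. -/
noncomputable def distCost (R : RandomizedAlgorithm n) (μ : PMF X) : ℝ≥0∞ :=
  ∑' x : X, μ x * R.expectedCost x

end RandomizedAlgorithm

/-- Average-case query complexity of the partial function `f` with success probability `γ`: the least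
worst-case (over inputs in `X`) expected cost of a randomized algorithm that computes `f` with
probability at least `γ` on every input in `X`. -/
noncomputable def averageCaseComplexity {n : ℕ} {X : Set (Fin n → Bool)} (f : X → Bool) (γ : ℝ) :
    ℝ≥0∞ :=
  ⨅ (R : RandomizedAlgorithm n) (_ : ENNReal.ofReal γ ≤ R.worstSuccess f), R.worstExpectedCost X

/-- Distributional query complexity of `f` for the input distribution `μ`: both the success
probability and the cost are averaged over `x ∼ μ` and over the randomness of the algorithm. -/
noncomputable def distributionalComplexity {n : ℕ} {X : Set (Fin n → Bool)} (f : X → Bool) (γ : ℝ)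
    (μ : PMF X) : ℝ≥0∞ :=
  ⨅ (R : RandomizedAlgorithm n) (_ : ENNReal.ofReal γ ≤ R.distSuccess f μ), R.distCost μ

/-- Maximum distributional query complexity of `f`: the maximum of the distributional complexity
over all distributions on the domain of `f`. -/
noncomputable def maxDistributionalComplexity {n : ℕ} {X : Set (Fin n → Bool)} (f : X → Bool)
    (γ : ℝ) : ℝ≥0∞ :=
  ⨆ μ : PMF X, distributionalComplexity f γ μ

/-! The witness has three blocks: `N` signs, `N` flags and `K`, about `1 / d`, potential marks,
where `d` is the advantage. With no flag raised, the value tells whether the signs have bias at most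
`4 * d` or at least `20 * d`. With a fraction of at least `r / 2` of the flags raised, the value
tells whether a mark exists, while the signs may carry any misleading bias up to `2 * b` in absolute
value; here `b` is of order `T * d` and `r = 4 * b`.

The distributional problem is cheap because the algorithm knows the frequency of flags. If the mean
flag rate `Φ` is at least `d`, it samples one flag with probability `d / Φ`, searches all marks if
that flag is raised and guesses otherwise; this gives advantage `d` at cost at most `1 + d * K =
O(1)` (`distributionalComplexity_le_of_flags`). If `Φ ≤ d`, flagged inputs are rare, and one random
sign or the constant `false` suffices (`distributionalComplexity_le_of_no_flags`).

A worst-case algorithm of expected cost `T` has no such knowledge. On unflagged inputs it must raise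
its acceptance probability by order `d` when the signs move from bias `0` to `40 * d`, so the slope
of acceptance in the bias is at least a constant. Few flags are seen in `m ^ 2` queries, where `m`
is of order `T`, so the slope persists on flagged inputs (`meanSlope_le_meanSlope`), and there a
bias `b` lifts acceptance by more than `2 * T * d`. Unmarked inputs of bias `b` must still be
rejected, so at bias `0` every single mark has to lift acceptance by at least as much. A mark
matters only when it is queried, hence the lifts of all `K` marks sum to at most the expected cost,
which contradicts `d * K ≥ 1` (`false_of_meanAccept`).

The analytic core is `abs_acceptProb_tilt_sub_slope_le`: acceptance is nearly linear in the bias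
although only the expected number of queries is bounded. Its errors require `T ^ 5 * d` to be small,
which `T = d ^ (-1 / 6)` ensures with room for constants. Advantages bounded below are handled by a
dictator function. -/

namespace DecisionTree

/-! ### Trees run on independent answers: stopping and perturbation estimates. -/

variable {n : ℕ}

/-- The probability that the tree outputs `true` when each query to coordinate `i` is answered by
an independent bit that is `true` with probability `θ i`. -/
noncomputable def acceptProb (θ : Fin n → ℝ) : DecisionTree n → ℝ
  | leaf b => if b then 1 else 0
  | query i t₀ t₁ => (1 - θ i) * acceptProb θ t₀ + θ i * acceptProb θ t₁

/-- The expected depth of the leaf reached under independent answers with biases `θ`. -/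
noncomputable def meanDepth (θ : Fin n → ℝ) : DecisionTree n → ℝ
  | leaf _ => 0
  | query i t₀ t₁ => 1 + ((1 - θ i) * meanDepth θ t₀ + θ i * meanDepth θ t₁)

/-- The expectation of a payoff collected after `k` queries, or earlier at a leaf. The payoff depends
on the remaining subtree and on the number of `true` minus the number of `false` answers to the
queries in `A`, started from `s`. -/
noncomputable def stoppedMean (A : Finset (Fin n)) (θ : Fin n → ℝ)
    (φ : ℝ → DecisionTree n → ℝ) : DecisionTree n → ℕ → ℝ → ℝ
  | leaf b, _, s => φ s (leaf b)
  | query i t₀ t₁, 0, s => φ s (query i t₀ t₁)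
  | query i t₀ t₁, k + 1, s =>
      (1 - θ i) * stoppedMean A θ φ t₀ k (s - if i ∈ A then 1 else 0) +
        θ i * stoppedMean A θ φ t₁ k (s + if i ∈ A then 1 else 0)

/-- Indicator of an internal node. -/
noncomputable def internal : DecisionTree n → ℝ
  | leaf _ => 0
  | query _ _ _ => 1

/-- Indicator of an accepting leaf. -/
noncomputable def accepting : DecisionTree n → ℝ
  | leaf b => if b then 1 else 0
  | query _ _ _ => 0

/-- The biases `θ` with those in `A` replaced by `(1 + p) / 2`. -/
noncomputable def tilt (A : Finset (Fin n)) (θ : Fin n → ℝ) (p : ℝ) : Fin n → ℝ :=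
  fun i => if i ∈ A then (1 + p) / 2 else θ i

variable {A : Finset (Fin n)} {θ θ' : Fin n → ℝ} {φ ψ : ℝ → DecisionTree n → ℝ}

theorem tilt_mem_Icc (h : ∀ i, θ i ∈ Set.Icc (0 : ℝ) 1) {p : ℝ} (hp : p ∈ Set.Icc (0 : ℝ) 1)
    (i : Fin n) : tilt A θ p i ∈ Set.Icc (0 : ℝ) 1 := by
  obtain ⟨h0, h1⟩ := hp
  unfold tilt
  split_ifs
  · constructor <;> linarith
  · exact h i

theorem acceptProb_mem_Icc (h : ∀ i, θ i ∈ Set.Icc (0 : ℝ) 1) (t : DecisionTree n) :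
    acceptProb θ t ∈ Set.Icc (0 : ℝ) 1 := by
  induction t with
  | leaf b => cases b <;> simp [acceptProb]
  | query i t₀ t₁ h₀ h₁ =>
    obtain ⟨a, b⟩ := h i
    obtain ⟨c, d⟩ := h₀
    obtain ⟨e, f⟩ := h₁
    simp only [acceptProb]
    constructor <;> nlinarith

theorem meanDepth_nonneg (h : ∀ i, θ i ∈ Set.Icc (0 : ℝ) 1) (t : DecisionTree n) :
    0 ≤ meanDepth θ t := by
  induction t with
  | leaf b => simp [meanDepth]
  | query i t₀ t₁ h₀ h₁ =>
    obtain ⟨a, b⟩ := h i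
    simp only [meanDepth]
    nlinarith

theorem stoppedMean_mono (h : ∀ i, θ i ∈ Set.Icc (0 : ℝ) 1) (hφ : ∀ s t, φ s t ≤ ψ s t)
    (t : DecisionTree n) (k : ℕ) (s : ℝ) :
    stoppedMean A θ φ t k s ≤ stoppedMean A θ ψ t k s := by
  induction t generalizing k s with
  | leaf b => exact hφ _ _
  | query i t₀ t₁ h₀ h₁ =>
    obtain ⟨a, b⟩ := h i
    cases k with
    | zero => exact hφ _ _
    | succ k =>
      simp only [stoppedMean]
      exact add_le_add (mul_le_mul_of_nonneg_left (h₀ _ _) (by linarith))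
        (mul_le_mul_of_nonneg_left (h₁ _ _) a)

theorem stoppedMean_linear (a b : ℝ) (t : DecisionTree n) (k : ℕ) (s : ℝ) :
    stoppedMean A θ (fun s t => a * φ s t + b * ψ s t) t k s =
      a * stoppedMean A θ φ t k s + b * stoppedMean A θ ψ t k s := by
  induction t generalizing k s with
  | leaf c => rfl
  | query i t₀ t₁ h₀ h₁ =>
    cases k with
    | zero => rfl
    | succ k =>
      simp only [stoppedMean, h₀, h₁]
      ring

theorem abs_stoppedMean_sub_le (h : ∀ i, θ i ∈ Set.Icc (0 : ℝ) 1) {χ : ℝ → DecisionTree n → ℝ}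
    (hφ : ∀ s t, |φ s t - ψ s t| ≤ χ s t) (t : DecisionTree n) (k : ℕ) (s : ℝ) :
    |stoppedMean A θ φ t k s - stoppedMean A θ ψ t k s| ≤ stoppedMean A θ χ t k s := by
  have e := stoppedMean_linear (A := A) (θ := θ) (φ := φ) (ψ := ψ) 1 (-1) t k s
  have e2 := stoppedMean_linear (A := A) (θ := θ) (φ := φ) (ψ := ψ) (-1) 1 t k s
  have m := stoppedMean_mono (A := A) (φ := fun s t => 1 * φ s t + (-1) * ψ s t) (ψ := χ) h
    (fun s t => by have := (abs_le.1 (hφ s t)).2; linarith) t k s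
  have m2 := stoppedMean_mono (A := A) (φ := fun s t => (-1) * φ s t + 1 * ψ s t) (ψ := χ) h
    (fun s t => by have := (abs_le.1 (hφ s t)).1; linarith) t k s
  rw [e] at m
  rw [e2] at m2
  rw [abs_le]
  constructor <;> linarith

theorem stoppedMean_acceptProb (t : DecisionTree n) (k : ℕ) (s : ℝ) :
    stoppedMean A θ (fun _ t => acceptProb θ t) t k s = acceptProb θ t := by
  induction t generalizing k s with
  | leaf c => rfl
  | query i t₀ t₁ h₀ h₁ =>
    cases k with
    | zero => rfl
    | succ k => simp only [stoppedMean, h₀, h₁, acceptProb]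

theorem stoppedMean_meanDepth_le (h : ∀ i, θ i ∈ Set.Icc (0 : ℝ) 1) (t : DecisionTree n) (k : ℕ)
    (s : ℝ) : stoppedMean A θ (fun _ t => meanDepth θ t) t k s ≤ meanDepth θ t := by
  induction t generalizing k s with
  | leaf c => exact le_rfl
  | query i t₀ t₁ h₀ h₁ =>
    cases k with
    | zero => exact le_rfl
    | succ k =>
      obtain ⟨a, b⟩ := h i
      simp only [stoppedMean, meanDepth]
      have := mul_le_mul_of_nonneg_left (h₀ k (s - if i ∈ A then 1 else 0)) (by linarith : 0 ≤ 1 - θ i)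
      have := mul_le_mul_of_nonneg_left (h₁ k (s + if i ∈ A then 1 else 0)) a
      linarith

/-- Markov's inequality for the depth. The factor is `k + 1` because a path standing at an internal
node after `k` queries makes at least one more. -/
theorem mul_stoppedMean_internal_le (h : ∀ i, θ i ∈ Set.Icc (0 : ℝ) 1) (t : DecisionTree n) (k : ℕ)
    (s : ℝ) : (k + 1) * stoppedMean A θ (fun _ t => internal t) t k s ≤ meanDepth θ t ∧
      stoppedMean A θ (fun _ t => internal t) t k s ∈ Set.Icc (0 : ℝ) 1 := by
  induction t generalizing k s with
  | leaf c => simp [stoppedMean, internal, meanDepth]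
  | query i t₀ t₁ h₀ h₁ =>
    obtain ⟨a, b⟩ := h i
    have n₀ := meanDepth_nonneg h t₀
    have n₁ := meanDepth_nonneg h t₁
    cases k with
    | zero =>
      simp only [stoppedMean, meanDepth, internal]
      refine ⟨?_, by simp⟩
      push_cast
      nlinarith
    | succ k =>
      simp only [stoppedMean, meanDepth]
      obtain ⟨p₀, q₀, r₀⟩ := h₀ k (s - if i ∈ A then 1 else 0)
      obtain ⟨p₁, q₁, r₁⟩ := h₁ k (s + if i ∈ A then 1 else 0)
      set X := stoppedMean A θ (fun _ t => internal t) t₀ k (s - if i ∈ A then 1 else 0)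
      set Y := stoppedMean A θ (fun _ t => internal t) t₁ k (s + if i ∈ A then 1 else 0)
      have := mul_le_mul_of_nonneg_left p₀ (by linarith : 0 ≤ 1 - θ i)
      have := mul_le_mul_of_nonneg_left p₁ a
      have hle : (1 - θ i) * X + θ i * Y ≤ 1 := by nlinarith
      refine ⟨?_, by nlinarith, hle⟩
      push_cast
      nlinarith

/-- Under unbiased signs, each query to `A` adds exactly `1` to the mean of `s ^ 2`, and other
queries leave `s` alone; so the second moment grows no faster than the number of queries. -/
theorem stoppedMean_sq_le (h : ∀ i, θ i ∈ Set.Icc (0 : ℝ) 1) (t : DecisionTree n) (k : ℕ) (s : ℝ) :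
    stoppedMean A (tilt A θ 0) (fun s _ => s ^ 2) t k s ≤ s ^ 2 + meanDepth (tilt A θ 0) t := by
  have ht := tilt_mem_Icc (A := A) h (p := 0) (by simp)
  induction t generalizing k s with
  | leaf c => simp [stoppedMean, meanDepth]
  | query i t₀ t₁ h₀ h₁ =>
    have n₀ := meanDepth_nonneg ht t₀
    have n₁ := meanDepth_nonneg ht t₁
    obtain ⟨a, b⟩ := ht i
    cases k with
    | zero =>
      simp only [stoppedMean, meanDepth]
      nlinarith
    | succ k =>
      simp only [stoppedMean, meanDepth]
      have e₀ := mul_le_mul_of_nonneg_left (h₀ k (s - if i ∈ A then 1 else 0))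
        (by linarith : 0 ≤ 1 - tilt A θ 0 i)
      have e₁ := mul_le_mul_of_nonneg_left (h₁ k (s + if i ∈ A then 1 else 0)) a
      by_cases hi : i ∈ A
      · have : tilt A θ 0 i = 1 / 2 := by simp [tilt, hi]
        simp only [hi, if_true, this] at *
        linarith
      · simp only [hi, if_false] at *
        linarith

/-- A hybrid argument: changing the bias of one query costs at most `r` times the difference of the
two subtree values, and these are bounded by `|s| + k`. The size bound is carried along to feed this
step. -/
theorem abs_stoppedMean_sub_stoppedMean_le (h : ∀ i, θ i ∈ Set.Icc (0 : ℝ) 1)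
    (h' : ∀ i, θ' i ∈ Set.Icc (0 : ℝ) 1) {r : ℝ} (hr : 0 ≤ r) (hθ : ∀ i, |θ i - θ' i| ≤ r)
    (hφ : ∀ s t, |φ s t| ≤ |s|) (t : DecisionTree n) (k : ℕ) (s : ℝ) :
    |stoppedMean A θ φ t k s| ≤ |s| + k ∧
    |stoppedMean A θ φ t k s - stoppedMean A θ' φ t k s| ≤ 2 * r * k * (|s| + k) := by
  induction t generalizing k s with
  | leaf c =>
    simp only [stoppedMean, sub_self, abs_zero]
    exact ⟨(hφ _ _).trans (by simp), by positivity⟩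
  | query i t₀ t₁ h₀ h₁ =>
    obtain ⟨a, b⟩ := h i
    obtain ⟨a', b'⟩ := h' i
    cases k with
    | zero =>
      simp only [stoppedMean, sub_self, abs_zero]
      exact ⟨(hφ _ _).trans (by simp), by positivity⟩
    | succ k =>
      simp only [stoppedMean]
      have s₀ : |s - if i ∈ A then 1 else 0| ≤ |s| + 1 :=
        (abs_sub _ _).trans (by gcongr; split_ifs <;> simp)
      have s₁ : |s + if i ∈ A then 1 else 0| ≤ |s| + 1 :=
        (abs_add_le _ _).trans (by gcongr; split_ifs <;> simp)
      obtain ⟨p₀, q₀⟩ := h₀ k (s - if i ∈ A then 1 else 0)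
      obtain ⟨p₁, q₁⟩ := h₁ k (s + if i ∈ A then 1 else 0)
      have hk : (0 : ℝ) ≤ k := Nat.cast_nonneg k
      replace p₀ : _ ≤ |s| + 1 + k := p₀.trans (by linarith)
      replace p₁ : _ ≤ |s| + 1 + k := p₁.trans (by linarith)
      replace q₀ : _ ≤ 2 * r * k * (|s| + 1 + k) :=
        q₀.trans (mul_le_mul_of_nonneg_left (by linarith) (by positivity))
      replace q₁ : _ ≤ 2 * r * k * (|s| + 1 + k) :=
        q₁.trans (mul_le_mul_of_nonneg_left (by linarith) (by positivity))
      generalize stoppedMean A θ φ t₀ k (s - if i ∈ A then 1 else 0) = X₀ at *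
      generalize stoppedMean A θ φ t₁ k (s + if i ∈ A then 1 else 0) = X₁ at *
      generalize stoppedMean A θ' φ t₀ k (s - if i ∈ A then 1 else 0) = Y₀ at *
      generalize stoppedMean A θ' φ t₁ k (s + if i ∈ A then 1 else 0) = Y₁ at *
      push_cast
      constructor
      · rw [abs_le] at *
        constructor <;> nlinarith
      · have e : (1 - θ i) * X₀ + θ i * X₁ - ((1 - θ' i) * Y₀ + θ' i * Y₁) =
            (θ i - θ' i) * (X₁ - X₀) + ((1 - θ' i) * (X₀ - Y₀) + θ' i * (X₁ - Y₁)) := by ring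
        rw [e]
        have e1 : |(θ i - θ' i) * (X₁ - X₀)| ≤ r * (2 * (|s| + 1 + k)) := by
          rw [abs_mul]
          refine mul_le_mul (hθ i) ?_ (abs_nonneg _) hr
          exact (abs_sub _ _).trans (by linarith)
        have e2 : |(1 - θ' i) * (X₀ - Y₀) + θ' i * (X₁ - Y₁)| ≤ 2 * r * k * (|s| + 1 + k) := by
          rw [abs_le] at *
          constructor <;> nlinarith
        refine (abs_add_le _ _).trans ((add_le_add e1 e2).trans (le_of_eq (by ring)))

theorem stoppedMean_const_shift (y : DecisionTree n → ℝ) (t : DecisionTree n) (k : ℕ) (s : ℝ) :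
    stoppedMean A θ (fun _ t => y t) t k s = stoppedMean A θ (fun _ t => y t) t k 0 := by
  induction t generalizing k s with
  | leaf c => rfl
  | query i t₀ t₁ h₀ h₁ =>
    cases k with
    | zero => rfl
    | succ k =>
      simp only [stoppedMean]
      rw [h₀, h₁, h₀ k (0 - _), h₁ k (0 + _)]

/-- Lets an induction stay at starting value `0` although a query moves the counter. -/
theorem stoppedMean_mul_shift (y : DecisionTree n → ℝ) (t : DecisionTree n) (k : ℕ) (s : ℝ) :
    stoppedMean A θ (fun s t => s * y t) t k s =
      s * stoppedMean A θ (fun _ t => y t) t k 0 + stoppedMean A θ (fun s t => s * y t) t k 0 := by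
  induction t generalizing k s with
  | leaf c => simp [stoppedMean]
  | query i t₀ t₁ h₀ h₁ =>
    cases k with
    | zero => simp [stoppedMean]
    | succ k =>
      simp only [stoppedMean]
      rw [h₀ k (s - _), h₁ k (s + _), h₀ k (0 - _), h₁ k (0 + _), stoppedMean_const_shift _ t₀ k (0 - _),
        stoppedMean_const_shift _ t₁ k (0 + _)]
      ring

end DecisionTree

/-! ### Linear response of the acceptance probability to the bias of the signs. -/

namespace DecisionTree

variable {n : ℕ} {A : Finset (Fin n)} {θ θ' : Fin n → ℝ}

/-- By the score-function formula, the derivative at `p = 0` is the mean of the payoff times the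
signed count. The first-order bound serves the induction for the second: the tilt of the root query
multiplies errors that are already of order `p * k`, and `p ^ 2 * k ^ 2 + p ^ 2 * k ≤ p ^ 2 * (k +
1) ^ 2`. -/
theorem abs_stoppedMean_tilt_sub_le (h : ∀ i, θ i ∈ Set.Icc (0 : ℝ) 1) {p : ℝ}
    (hp : p ∈ Set.Icc (0 : ℝ) 1) {y : DecisionTree n → ℝ} (hy : ∀ t, y t ∈ Set.Icc (0 : ℝ) 1)
    (t : DecisionTree n) (k : ℕ) :
    stoppedMean A (tilt A θ p) (fun _ t => y t) t k 0 ∈ Set.Icc (0 : ℝ) 1 ∧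
    |stoppedMean A (tilt A θ p) (fun _ t => y t) t k 0 -
      stoppedMean A (tilt A θ 0) (fun _ t => y t) t k 0| ≤ p * k ∧
    |stoppedMean A (tilt A θ p) (fun _ t => y t) t k 0 -
      stoppedMean A (tilt A θ 0) (fun _ t => y t) t k 0 -
      p * stoppedMean A (tilt A θ 0) (fun s t => s * y t) t k 0| ≤ p ^ 2 * k ^ 2 := by
  have hp' := hp
  obtain ⟨hp0, hp1⟩ := hp'
  induction t generalizing k with
  | leaf c =>
    simp only [stoppedMean, zero_mul, mul_zero, sub_self, abs_zero]
    exact ⟨hy _, by positivity, by positivity⟩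
  | query i t₀ t₁ h₀ h₁ =>
    cases k with
    | zero =>
      simp only [stoppedMean, zero_mul, mul_zero, sub_self, abs_zero]
      exact ⟨hy _, by positivity, by positivity⟩
    | succ k =>
      simp only [stoppedMean]
      rw [stoppedMean_const_shift y t₀ k (0 - _), stoppedMean_const_shift y t₁ k (0 + _),
        stoppedMean_const_shift y t₀ k (0 - _), stoppedMean_const_shift y t₁ k (0 + _),
        stoppedMean_mul_shift y t₀ k (0 - _), stoppedMean_mul_shift y t₁ k (0 + _)]
      obtain ⟨⟨a₀, b₀⟩, c₀, d₀⟩ := h₀ k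
      obtain ⟨⟨a₁, b₁⟩, c₁, d₁⟩ := h₁ k
      generalize stoppedMean A (tilt A θ p) (fun _ t => y t) t₀ k 0 = X₀ at *
      generalize stoppedMean A (tilt A θ p) (fun _ t => y t) t₁ k 0 = X₁ at *
      generalize stoppedMean A (tilt A θ 0) (fun _ t => y t) t₀ k 0 = Y₀ at *
      generalize stoppedMean A (tilt A θ 0) (fun _ t => y t) t₁ k 0 = Y₁ at *
      generalize stoppedMean A (tilt A θ 0) (fun s t => s * y t) t₀ k 0 = Z₀ at *
      generalize stoppedMean A (tilt A θ 0) (fun s t => s * y t) t₁ k 0 = Z₁ at *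
      have hk : (0 : ℝ) ≤ k := Nat.cast_nonneg k
      have hpk : 0 ≤ p * k := by positivity
      have hppk : p * (p * k) = p ^ 2 * k := by ring
      have hppk0 : 0 ≤ p ^ 2 * k := by positivity
      rw [abs_le] at c₀ c₁ d₀ d₁
      push_cast
      by_cases hi : i ∈ A
      · simp only [hi, tilt, if_true]
        refine ⟨by constructor <;> nlinarith, ?_, ?_⟩
        · rw [abs_le]
          constructor <;> nlinarith
        · have e1 : |p * ((X₁ - Y₁) - (X₀ - Y₀))| ≤ p * (2 * (p * k)) := by
            rw [abs_mul, abs_of_nonneg hp0]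
            exact mul_le_mul_of_nonneg_left (by rw [abs_le]; constructor <;> linarith) hp0
          rw [abs_le] at e1 ⊢
          constructor <;> nlinarith
      · obtain ⟨a, b⟩ := h i
        simp only [hi, tilt, if_false]
        refine ⟨by constructor <;> nlinarith, ?_, ?_⟩
        · rw [abs_le]
          constructor <;> nlinarith
        · have hle : p ^ 2 * (k : ℝ) ^ 2 ≤ p ^ 2 * (k + 1) ^ 2 := by gcongr; linarith
          refine le_trans ?_ hle
          rw [abs_le]
          constructor <;> nlinarith

/-- The unbiased acceptance probability `v` of the current subtree is a martingale under bias `0`.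
Under bias `p` it drifts by at most a multiple of `p` times its increment, and the concave potential
`a * v * (1 - v)` loses a multiple of the squared increment, which absorbs the drift up to `p ^ 2 /
a` per query. The sign `e` yields both directions. -/
theorem acceptProb_tilt_le_potential (h : ∀ i, θ i ∈ Set.Icc (0 : ℝ) 1) {p : ℝ}
    (hp : p ∈ Set.Icc (0 : ℝ) 1) {a : ℝ} (ha : a ∈ Set.Ioc (0 : ℝ) 1) {e : ℝ} (he : |e| = 1)
    (t : DecisionTree n) :
    e * acceptProb (tilt A θ p) t ≤ e * acceptProb (tilt A θ 0) t +
      a * (acceptProb (tilt A θ 0) t * (1 - acceptProb (tilt A θ 0) t)) +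
      p ^ 2 / a * meanDepth (tilt A θ p) t := by
  have hp' := hp
  obtain ⟨hp0, hp1⟩ := hp'
  obtain ⟨ha0, ha1⟩ := ha
  have hq : 0 ≤ p ^ 2 / a := by positivity
  induction t with
  | leaf b => cases b <;> simp [acceptProb, meanDepth]
  | query i t₀ t₁ h₀ h₁ =>
    simp only [acceptProb, meanDepth]
    obtain ⟨u₀, v₀⟩ := acceptProb_mem_Icc (tilt_mem_Icc (A := A) h (p := 0) (by simp)) t₀
    obtain ⟨u₁, v₁⟩ := acceptProb_mem_Icc (tilt_mem_Icc (A := A) h (p := 0) (by simp)) t₁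
    generalize acceptProb (tilt A θ 0) t₀ = x at *
    generalize acceptProb (tilt A θ 0) t₁ = y at *
    obtain ⟨w₀, w₁⟩ := tilt_mem_Icc (A := A) h hp i
    have k₀ := mul_le_mul_of_nonneg_left h₀ (by linarith : 0 ≤ 1 - tilt A θ p i)
    have k₁ := mul_le_mul_of_nonneg_left h₁ w₀
    generalize meanDepth (tilt A θ p) t₀ = c₀ at *
    generalize meanDepth (tilt A θ p) t₁ = c₁ at *
    have key : (1 - tilt A θ p i) * (e * x + a * (x * (1 - x))) +
        tilt A θ p i * (e * y + a * (y * (1 - y))) ≤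
        e * ((1 - tilt A θ 0 i) * x + tilt A θ 0 i * y) +
        a * (((1 - tilt A θ 0 i) * x + tilt A θ 0 i * y) *
          (1 - ((1 - tilt A θ 0 i) * x + tilt A θ 0 i * y))) + p ^ 2 / a := by
      by_cases hi : i ∈ A
      · simp only [tilt, hi, if_true]
        set z := y - x
        have hz : y = x + z := by simp [z]
        have hs : |e + a * (1 - x - y)| ≤ 2 := by
          refine (abs_add_le _ _).trans ?_
          rw [he, abs_mul, abs_of_pos ha0]
          have : |1 - x - y| ≤ 1 := by rw [abs_le]; constructor <;> linarith
          nlinarith [abs_nonneg (1 - x - y)]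
        -- The first term is the gain from tilting the answer, the second the concavity loss of `v *
        -- (1 - v)` at a fair coin; completing the square in `|z|` leaves `p ^ 2 / a`.
        have hdiff : p / 2 * (z * (e + a * (1 - x - y))) - a / 4 * z ^ 2 ≤ p ^ 2 / a := by
          have h1 : z * (e + a * (1 - x - y)) ≤ |z| * 2 :=
            (le_abs_self _).trans (by rw [abs_mul]; gcongr)
          have h2 : p * |z| - a / 4 * z ^ 2 ≤ p ^ 2 / a := by
            rw [le_div_iff₀ ha0, ← sq_abs z]
            nlinarith [sq_nonneg (p - a * |z| / 2)]
          nlinarith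
        rw [hz] at hdiff ⊢
        nlinarith
      · simp only [tilt, hi, if_false]
        obtain ⟨a1, b1⟩ := h i
        have : 0 ≤ a * (θ i * (1 - θ i) * (x - y) ^ 2) := by
          have : 0 ≤ 1 - θ i := by linarith
          positivity
        nlinarith
    linarith

/-- The potential is at most `a / 4` and is needed only at internal nodes. The factor `internal t`
makes this error small after many queries, when few paths are still running. -/
theorem abs_acceptProb_tilt_sub_le (h : ∀ i, θ i ∈ Set.Icc (0 : ℝ) 1) {p : ℝ}
    (hp : p ∈ Set.Icc (0 : ℝ) 1) {a : ℝ} (ha : a ∈ Set.Ioc (0 : ℝ) 1) (t : DecisionTree n) :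
    |acceptProb (tilt A θ p) t - acceptProb (tilt A θ 0) t| ≤
      a / 4 * internal t + p ^ 2 / a * meanDepth (tilt A θ p) t := by
  cases t with
  | leaf b => simp [acceptProb, internal, meanDepth]
  | query i t₀ t₁ =>
    have h1 := acceptProb_tilt_le_potential (A := A) h hp ha (e := 1) (by simp) (query i t₀ t₁)
    have h2 := acceptProb_tilt_le_potential (A := A) h hp ha (e := -1) (by simp) (query i t₀ t₁)
    have h3 : ∀ x : ℝ, a * (x * (1 - x)) ≤ a / 4 := fun x => by
      nlinarith [mul_nonneg ha.1.le (sq_nonneg (x - 1 / 2))]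
    have := h3 (acceptProb (tilt A θ 0) (query i t₀ t₁))
    simp only [internal]
    rw [abs_le]
    constructor <;> linarith

/-- The linear coefficient, in the bias of the coordinates of `A`, of the probability that the tree
accepts within `k` queries. -/
noncomputable def slope (A : Finset (Fin n)) (θ : Fin n → ℝ) (k : ℕ) (t : DecisionTree n) : ℝ :=
  stoppedMean A (tilt A θ 0) (fun s t => s * accepting t) t k 0

/-- Each path is stopped after `m ^ 2` queries. The bounded part is expanded to first order in `p`;
the unfinished part is rare by Markov's inequality and is controlled by the potential and by second
moments. The errors are linear in the expected depths, so they can be averaged over a randomized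
algorithm. -/
theorem abs_acceptProb_tilt_sub_slope_le (h : ∀ i, θ i ∈ Set.Icc (0 : ℝ) 1) {p : ℝ}
    (hp0 : 0 < p) {m : ℕ} (hm : 1 ≤ m) (hpm : p * m ≤ 1) (t : DecisionTree n) :
    |acceptProb (tilt A θ p) t - acceptProb (tilt A θ 0) t - p * slope A θ (m ^ 2) t| ≤
      p * (5 / 4 / m * meanDepth (tilt A θ p) t + 1 / m * meanDepth (tilt A θ 0) t +
        p * (m : ℝ) ^ 4) := by
  have hm' : (1 : ℝ) ≤ m := by exact_mod_cast hm
  have hp : p ∈ Set.Icc (0 : ℝ) 1 := ⟨hp0.le, by nlinarith⟩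
  have tp := tilt_mem_Icc (A := A) h hp
  have t0 := tilt_mem_Icc (A := A) h (p := 0) (by simp)
  set L := m ^ 2
  -- the dependence of the payoff on the bias
  have s1 : |acceptProb (tilt A θ p) t -
      stoppedMean A (tilt A θ p) (fun _ t => acceptProb (tilt A θ 0) t) t L 0| ≤
      p * (5 / 4 / m * meanDepth (tilt A θ p) t) := by
    -- The choice `a = p * m` balances the two terms: unfinished paths have probability at most
    -- depth divided by `m ^ 2`, so both become of order `p / m` times the depth.
    have e := abs_stoppedMean_sub_le (A := A) tp (φ := fun _ t => acceptProb (tilt A θ p) t)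
      (ψ := fun _ t => acceptProb (tilt A θ 0) t)
      (χ := fun _ t => p * m / 4 * internal t + p ^ 2 / (p * m) * meanDepth (tilt A θ p) t)
      (fun _ t => abs_acceptProb_tilt_sub_le h hp ⟨by positivity, hpm⟩ t) t L 0
    rw [stoppedMean_acceptProb] at e
    refine e.trans ?_
    rw [stoppedMean_linear (φ := fun _ t => internal t) (ψ := fun _ t => meanDepth (tilt A θ p) t)]
    have e1 := stoppedMean_meanDepth_le (A := A) tp t L 0
    obtain ⟨e2, e3, -⟩ := mul_stoppedMean_internal_le (A := A) tp t L 0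
    generalize stoppedMean A (tilt A θ p) (fun _ t => internal t) t L 0 = I at *
    have e4 : (m : ℝ) ^ 2 * I ≤ meanDepth (tilt A θ p) t := by
      simp only [L] at e2; push_cast at e2; nlinarith
    have e5 : p * m / 4 * I ≤ p * (1 / 4 / m * meanDepth (tilt A θ p) t) := by
      have : p * (1 / 4 / m * meanDepth (tilt A θ p) t) =
        p / (4 * m) * meanDepth (tilt A θ p) t := by field_simp
      rw [this]
      calc p * m / 4 * I = p / (4 * m) * ((m : ℝ) ^ 2 * I) := by field_simp
        _ ≤ _ := by gcongr
    have e6 : p ^ 2 / (p * m) = p * (1 / m) := by field_simp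
    rw [e6]
    have e7 := mul_le_mul_of_nonneg_left e1 (by positivity : 0 ≤ p * (1 / (m : ℝ)))
    have : p * (5 / 4 / m * meanDepth (tilt A θ p) t) =
      p * (1 / 4 / m * meanDepth (tilt A θ p) t) + p * (1 / m) * meanDepth (tilt A θ p) t := by ring
    rw [this]
    linarith
  -- the expansion up to the stopping time
  obtain ⟨-, -, s2⟩ := abs_stoppedMean_tilt_sub_le (A := A) h hp
    (y := fun t => acceptProb (tilt A θ 0) t) (fun t => acceptProb_mem_Icc t0 t) t L
  rw [stoppedMean_acceptProb] at s2
  -- the contribution of the unfinished paths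
  have s3 : |stoppedMean A (tilt A θ 0) (fun s t => s * acceptProb (tilt A θ 0) t) t L 0 -
      slope A θ L t| ≤ 1 / m * meanDepth (tilt A θ 0) t := by
    -- At an unfinished node the error is at most `|s|`, split by AM-GM as `|s| ≤ s ^ 2 / (2 * m) +
    -- m / 2`.
    refine (abs_stoppedMean_sub_le (A := A) t0
      (χ := fun s t => 1 / (2 * m) * s ^ 2 + m / 2 * internal t) (fun s t => ?_) t L 0).trans ?_
    · cases t with
      | leaf b =>
        simp only [acceptProb, accepting, sub_self, abs_zero, internal]
        positivity
      | query i t₀ t₁ =>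
        simp only [accepting, internal, mul_zero, sub_zero, mul_one]
        obtain ⟨a, b⟩ := acceptProb_mem_Icc t0 (query i t₀ t₁)
        have h1 : |s * acceptProb (tilt A θ 0) (query i t₀ t₁)| ≤ |s| := by
          rw [abs_mul, abs_of_nonneg a]
          exact mul_le_of_le_one_right (abs_nonneg _) b
        refine h1.trans ?_
        rw [← sq_abs s]
        have : 1 / (2 * m) * |s| ^ 2 + m / 2 - |s| = 1 / (2 * m) * (|s| - m) ^ 2 := by
          field_simp
          ring
        have : 0 ≤ 1 / (2 * (m : ℝ)) * (|s| - m) ^ 2 := by positivity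
        linarith
    · rw [stoppedMean_linear (φ := fun s _ => s ^ 2) (ψ := fun _ t => internal t)]
      have e1 := stoppedMean_sq_le (A := A) h t L 0
      obtain ⟨e2, e3, -⟩ := mul_stoppedMean_internal_le (A := A) t0 t L 0
      generalize stoppedMean A (tilt A θ 0) (fun _ t => internal t) t L 0 = I at *
      generalize stoppedMean A (tilt A θ 0) (fun s _ => s ^ 2) t L 0 = J at *
      have e4 : (m : ℝ) ^ 2 * I ≤ meanDepth (tilt A θ 0) t := by
        simp only [L] at e2; push_cast at e2; nlinarith
      calc 1 / (2 * m) * J + m / 2 * I = 1 / (2 * m) * J + 1 / (2 * m) * ((m : ℝ) ^ 2 * I) := by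
            field_simp
        _ ≤ 1 / (2 * m) * meanDepth (tilt A θ 0) t + 1 / (2 * m) * meanDepth (tilt A θ 0) t := by
            gcongr; linarith
        _ = _ := by ring
  have s4 := mul_le_mul_of_nonneg_left s3 hp0.le
  rw [← abs_of_pos hp0, ← abs_mul, abs_of_pos hp0] at s4
  have e : acceptProb (tilt A θ p) t - acceptProb (tilt A θ 0) t - p * slope A θ L t =
      (acceptProb (tilt A θ p) t -
        stoppedMean A (tilt A θ p) (fun _ t => acceptProb (tilt A θ 0) t) t L 0) +
      (stoppedMean A (tilt A θ p) (fun _ t => acceptProb (tilt A θ 0) t) t L 0 -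
        acceptProb (tilt A θ 0) t -
        p * stoppedMean A (tilt A θ 0) (fun s t => s * acceptProb (tilt A θ 0) t) t L 0) +
      p * (stoppedMean A (tilt A θ 0) (fun s t => s * acceptProb (tilt A θ 0) t) t L 0 -
        slope A θ L t) := by ring
  rw [e]
  refine (abs_add_three _ _ _).trans ?_
  have e' : p ^ 2 * (L : ℝ) ^ 2 = p * (p * (m : ℝ) ^ 4) := by simp only [L]; push_cast; ring
  rw [e'] at s2
  linarith

theorem abs_accepting_le (s : ℝ) (t : DecisionTree n) : |s * accepting t| ≤ |s| := by
  rw [abs_mul]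
  refine mul_le_of_le_one_right (abs_nonneg _) ?_
  cases t with
  | leaf b => cases b <;> simp [accepting]
  | query i t₀ t₁ => simp [accepting]

theorem abs_slope_le (h : ∀ i, θ i ∈ Set.Icc (0 : ℝ) 1) (k : ℕ) (t : DecisionTree n) :
    |slope A θ k t| ≤ k := by
  have t0 := tilt_mem_Icc (A := A) h (p := 0) (by simp)
  have := (abs_stoppedMean_sub_stoppedMean_le (A := A) t0 t0 le_rfl (fun i => by simp)
    abs_accepting_le t k 0).1
  simpa [slope] using this

theorem abs_slope_sub_slope_le (h : ∀ i, θ i ∈ Set.Icc (0 : ℝ) 1)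
    (h' : ∀ i, θ' i ∈ Set.Icc (0 : ℝ) 1) {r : ℝ} (hr : 0 ≤ r) (hθ : ∀ i, |θ i - θ' i| ≤ r)
    (k : ℕ) (t : DecisionTree n) : |slope A θ k t - slope A θ' k t| ≤ 2 * r * k * k := by
  have t0 := tilt_mem_Icc (A := A) h (p := 0) (by simp)
  have t0' := tilt_mem_Icc (A := A) h' (p := 0) (by simp)
  have := (abs_stoppedMean_sub_stoppedMean_le (A := A) t0 t0' hr (fun i => ?_)
    abs_accepting_le t k 0).2
  · simpa [slope] using this
  · unfold tilt
    split_ifs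
    · simpa using hr
    · exact hθ i

/-- Setting one of the coordinates of `J` to `true` is noticed only if this coordinate is queried. -/
theorem sum_abs_acceptProb_update_sub_le (h : ∀ i, θ i ∈ Set.Icc (0 : ℝ) 1) (J : Finset (Fin n))
    (t : DecisionTree n) :
    ∑ j ∈ J, |acceptProb (Function.update θ j 1) t - acceptProb θ t| ≤ meanDepth θ t := by
  induction t with
  | leaf b => simp [acceptProb, meanDepth]
  | query i t₀ t₁ h₀ h₁ =>
    obtain ⟨a, b⟩ := h i
    have hupd : ∀ j ∈ J, ∀ k, Function.update θ j 1 k ∈ Set.Icc (0 : ℝ) 1 := by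
      intro j _ k
      by_cases hk : k = j
      · subst hk; simp
      · simpa [hk] using h k
    have hterm : ∀ j ∈ J, |acceptProb (Function.update θ j 1) (query i t₀ t₁) -
        acceptProb θ (query i t₀ t₁)| ≤ (if j = i then 1 else 0) +
        ((1 - θ i) * |acceptProb (Function.update θ j 1) t₀ - acceptProb θ t₀| +
          θ i * |acceptProb (Function.update θ j 1) t₁ - acceptProb θ t₁|) := by
      intro j hj
      by_cases hi : j = i
      · rw [if_pos hi]
        obtain ⟨u, v⟩ := acceptProb_mem_Icc (hupd j hj) (query i t₀ t₁)
        obtain ⟨u', v'⟩ := acceptProb_mem_Icc h (query i t₀ t₁)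
        have : |acceptProb (Function.update θ j 1) (query i t₀ t₁) -
          acceptProb θ (query i t₀ t₁)| ≤ 1 := by rw [abs_le]; constructor <;> linarith
        have : 0 ≤ 1 - θ i := by linarith
        have : 0 ≤ (1 - θ i) * |acceptProb (Function.update θ j 1) t₀ - acceptProb θ t₀| +
          θ i * |acceptProb (Function.update θ j 1) t₁ - acceptProb θ t₁| := by positivity
        linarith
      · have hi' : i ≠ j := fun e => hi e.symm
        simp only [hi, if_false, acceptProb, Function.update_of_ne hi', zero_add]
        have : (1 - θ i) * acceptProb (Function.update θ j 1) t₀ +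
            θ i * acceptProb (Function.update θ j 1) t₁ -
            ((1 - θ i) * acceptProb θ t₀ + θ i * acceptProb θ t₁) =
            (1 - θ i) * (acceptProb (Function.update θ j 1) t₀ - acceptProb θ t₀) +
            θ i * (acceptProb (Function.update θ j 1) t₁ - acceptProb θ t₁) := by ring
        rw [this]
        refine (abs_add_le _ _).trans ?_
        rw [abs_mul, abs_mul, abs_of_nonneg a, abs_of_nonneg (by linarith : 0 ≤ 1 - θ i)]
    refine (Finset.sum_le_sum hterm).trans ?_
    rw [Finset.sum_add_distrib, Finset.sum_add_distrib, ← Finset.mul_sum, ← Finset.mul_sum]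
    simp only [meanDepth]
    refine add_le_add ?_ (add_le_add (mul_le_mul_of_nonneg_left h₀ (by linarith))
      (mul_le_mul_of_nonneg_left h₁ a))
    rw [Finset.sum_ite_eq']
    split_ifs <;> norm_num

end DecisionTree

/-! ### Product measures on the cube and Chebyshev's inequality. -/

section BernoulliCube

variable {n : ℕ} {θ : Fin n → ℝ} {F G : (Fin n → Bool) → ℝ}

/-- The probability of `x` when the coordinates are independent and `true` with probability `θ i`. -/
noncomputable def bernWeight (θ : Fin n → ℝ) (x : Fin n → Bool) : ℝ :=
  ∏ i, if x i then θ i else 1 - θ i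

/-- Expectation over independent bits with biases `θ`. -/
noncomputable def bernMean (θ : Fin n → ℝ) (F : (Fin n → Bool) → ℝ) : ℝ :=
  ∑ x, bernWeight θ x * F x

theorem bernWeight_nonneg (h : ∀ i, θ i ∈ Set.Icc (0 : ℝ) 1) (x : Fin n → Bool) :
    0 ≤ bernWeight θ x := by
  refine Finset.prod_nonneg fun i _ => ?_
  obtain ⟨a, b⟩ := h i
  split_ifs <;> linarith

theorem bernMean_add : bernMean θ (fun x => F x + G x) = bernMean θ F + bernMean θ G := by
  simp only [bernMean, mul_add, Finset.sum_add_distrib]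

theorem bernMean_const_mul (c : ℝ) : bernMean θ (fun x => c * F x) = c * bernMean θ F := by
  simp only [bernMean, Finset.mul_sum]
  exact Finset.sum_congr rfl fun _ _ => by ring

theorem bernMean_mono (h : ∀ i, θ i ∈ Set.Icc (0 : ℝ) 1)
    (hFG : ∀ x, 0 < bernWeight θ x → F x ≤ G x) : bernMean θ F ≤ bernMean θ G := by
  refine Finset.sum_le_sum fun x _ => ?_
  rcases (bernWeight_nonneg h x).eq_or_lt with e | e
  · simp [← e]
  · exact mul_le_mul_of_nonneg_left (hFG x e) e.le

theorem bernMean_one : bernMean θ (fun _ => 1) = 1 := by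
  simp only [bernMean, bernWeight, mul_one]
  have := (Finset.prod_univ_sum (fun _ : Fin n => (Finset.univ : Finset Bool))
    (fun i b => if b = true then θ i else 1 - θ i)).symm
  rw [Fintype.piFinset_univ] at this
  rw [this]
  simp

theorem bernMean_const (c : ℝ) : bernMean θ (fun _ => c) = c := by
  have := bernMean_const_mul (θ := θ) (F := fun _ => 1) c
  rw [bernMean_one] at this
  simpa using this

theorem bernMean_split (i : Fin n) :
    bernMean θ F = (1 - θ i) * bernMean θ (fun x => F (Function.update x i false)) +
      θ i * bernMean θ (fun x => F (Function.update x i true)) := by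
  set w : (Fin n → Bool) → ℝ := fun x => ∏ j ∈ Finset.univ.erase i, if x j then θ j else 1 - θ j
  have hw : ∀ x b, w (Function.update x i b) = w x := by
    intro x b
    refine Finset.prod_congr rfl fun j hj => ?_
    rw [Function.update_of_ne (Finset.ne_of_mem_erase hj)]
  have hbw : ∀ x, bernWeight θ x = (if x i then θ i else 1 - θ i) * w x := fun x =>
    (Finset.mul_prod_erase Finset.univ _ (Finset.mem_univ i)).symm
  -- Pairs every `x` having `x i = true` with its flip at `i`, so that both sides become sums over
  -- the same half cube.
  have half : ∀ H : (Fin n → Bool) → ℝ,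
      ∑ x, H x = ∑ x, if x i then H x + H (Function.update x i false) else 0 := by
    intro H
    have e1 : ∑ x, H x = ∑ x, ((if x i then H x else 0) + (if x i then 0 else H x)) :=
      Finset.sum_congr rfl fun x _ => by split_ifs <;> simp
    have e2 : ∑ x, (if x i then 0 else H x) =
        ∑ x, if x i then H (Function.update x i false) else 0 := by
      refine Finset.sum_nbij' (fun x => Function.update x i (!x i))
        (fun x => Function.update x i (!x i)) (by simp) (by simp) (by simp) (by simp) ?_
      intro x _
      cases hx : x i
      · simp [← hx]
      · simp
    rw [e1, Finset.sum_add_distrib, e2, ← Finset.sum_add_distrib]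
    exact Finset.sum_congr rfl fun x _ => by split_ifs <;> simp
  unfold bernMean
  rw [half (fun x => bernWeight θ x * F x),
    half (fun x => bernWeight θ x * F (Function.update x i false)),
    half (fun x => bernWeight θ x * F (Function.update x i true)), Finset.mul_sum, Finset.mul_sum,
    ← Finset.sum_add_distrib]
  refine Finset.sum_congr rfl fun x _ => ?_
  split_ifs with hx
  · have hx' : Function.update x i true = x := by rw [← hx]; simp
    simp only [hbw, hw, Function.update_self, Function.update_idem, hx, hx', if_true,
      Bool.false_eq_true, if_false]
    ring
  · simp

theorem bernMean_mul_centered (i : Fin n)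
    (hF : ∀ x b, F (Function.update x i b) = F x) :
    bernMean θ (fun x => ((if x i then 1 else 0) - θ i) * F x) = 0 := by
  rw [bernMean_split i]
  simp only [Function.update_self, hF, if_true, Bool.false_eq_true, if_false, bernMean_const_mul]
  ring

theorem bernMean_sum {ι : Type*} (s : Finset ι) (H : ι → (Fin n → Bool) → ℝ) :
    bernMean θ (fun x => ∑ a ∈ s, H a x) = ∑ a ∈ s, bernMean θ (H a) := by
  simp only [bernMean, Finset.mul_sum]
  exact Finset.sum_comm

/-- Off-diagonal products vanish by independence, and each variance is `θ * (1 - θ) ≤ 1 / 4`. -/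
theorem bernMean_sq_sum_le (S : Finset (Fin n)) :
    bernMean θ (fun x => (∑ i ∈ S, ((if x i then 1 else 0) - θ i)) ^ 2) ≤ S.card / 4 := by
  have e : ∀ x : Fin n → Bool, (∑ i ∈ S, ((if x i then (1 : ℝ) else 0) - θ i)) ^ 2 =
      ∑ i ∈ S, ∑ j ∈ S, ((if x i then (1 : ℝ) else 0) - θ i) * ((if x j then 1 else 0) - θ j) := by
    intro x; rw [sq, Finset.sum_mul_sum]
  simp only [e]
  rw [bernMean_sum]
  have : ∀ i ∈ S, bernMean θ (fun x => ∑ j ∈ S,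
      ((if x i then (1 : ℝ) else 0) - θ i) * ((if x j then 1 else 0) - θ j)) ≤ 1 / 4 := by
    intro i hi
    rw [bernMean_sum, Finset.sum_eq_single_of_mem i hi]
    · rw [bernMean_split i]
      simp only [Function.update_self, if_true, Bool.false_eq_true, if_false, bernMean_const]
      nlinarith [sq_nonneg (θ i - 1 / 2)]
    · intro j _ hj
      refine bernMean_mul_centered i fun x b => ?_
      rw [Function.update_of_ne hj]
  refine (Finset.sum_le_sum this).trans (le_of_eq ?_)
  rw [Finset.sum_const, nsmul_eq_mul]
  ring

/-- Chebyshev's inequality for a sum of independent bits. -/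
theorem bernMean_deviation_le (h : ∀ i, θ i ∈ Set.Icc (0 : ℝ) 1) (S : Finset (Fin n)) {s : ℝ}
    (hs : 0 < s) :
    bernMean θ (fun x => if s ≤ |∑ i ∈ S, ((if x i then 1 else 0) - θ i)| then 1 else 0) ≤
      S.card / (4 * s ^ 2) := by
  have h1 : bernMean θ (fun x => if s ≤ |∑ i ∈ S, ((if x i then 1 else 0) - θ i)| then 1 else 0) ≤
      bernMean θ (fun x => 1 / s ^ 2 * (∑ i ∈ S, ((if x i then 1 else 0) - θ i)) ^ 2) := by
    refine bernMean_mono h fun x _ => ?_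
    split_ifs with hx
    · have : s ^ 2 ≤ (∑ i ∈ S, ((if x i then (1 : ℝ) else 0) - θ i)) ^ 2 := by
        rw [← sq_abs (∑ i ∈ S, _)]; gcongr
      rw [one_div, ← div_eq_inv_mul, le_div_iff₀ (by positivity)]
      linarith
    · positivity
  rw [bernMean_const_mul] at h1
  refine h1.trans ((mul_le_mul_of_nonneg_left (bernMean_sq_sum_le S) (by positivity)).trans
    (le_of_eq ?_))
  field_simp

end BernoulliCube

/-! ### Removing repeated queries and truncating trees. -/

namespace DecisionTree

variable {n : ℕ} {θ : Fin n → ℝ}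

/-- No path queries a coordinate of `S` or the same coordinate twice. -/
def ReadOnce : Finset (Fin n) → DecisionTree n → Prop
  | _, leaf _ => True
  | S, query i t₀ t₁ => i ∉ S ∧ ReadOnce (insert i S) t₀ ∧ ReadOnce (insert i S) t₁

theorem ReadOnce.eval_cost_update {t : DecisionTree n} {S : Finset (Fin n)} (ht : ReadOnce S t)
    {i : Fin n} (hi : i ∈ S) (x : Fin n → Bool) (b : Bool) :
    t.eval (Function.update x i b) = t.eval x ∧ t.cost (Function.update x i b) = t.cost x := by
  induction t generalizing S with
  | leaf c => exact ⟨rfl, rfl⟩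
  | query j t₀ t₁ h₀ h₁ =>
    obtain ⟨hj, r₀, r₁⟩ := ht
    have hji : j ≠ i := fun e => hj (e ▸ hi)
    have hi' := Finset.mem_insert_of_mem (b := j) hi
    simp only [eval, cost, Function.update_of_ne hji, (h₀ r₀ hi').1, (h₀ r₀ hi').2,
      (h₁ r₁ hi').1, (h₁ r₁ hi').2, and_self]

/-- Once `i` has been queried, neither subtree depends on it, so answers along a path really are
independent. With repeated queries `acceptProb` would redraw a bit already read. -/
theorem ReadOnce.bernMean_eval {t : DecisionTree n} {S : Finset (Fin n)} (ht : ReadOnce S t) :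
    bernMean θ (fun x => if t.eval x then 1 else 0) = acceptProb θ t := by
  induction t generalizing S with
  | leaf c => exact bernMean_const (θ := θ) (if c then 1 else 0)
  | query i t₀ t₁ h₀ h₁ =>
    obtain ⟨hi, r₀, r₁⟩ := ht
    have hi' := Finset.mem_insert_self i S
    rw [bernMean_split i, acceptProb, ← h₀ r₀, ← h₁ r₁]
    simp only [eval, Function.update_self, if_true, Bool.false_eq_true, if_false,
      (r₀.eval_cost_update hi' _ _).1, (r₁.eval_cost_update hi' _ _).1]

theorem ReadOnce.bernMean_cost {t : DecisionTree n} {S : Finset (Fin n)} (ht : ReadOnce S t) :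
    bernMean θ (fun x => (t.cost x : ℝ)) = meanDepth θ t := by
  induction t generalizing S with
  | leaf c => simp only [cost, meanDepth, bernMean_const, Nat.cast_zero]
  | query i t₀ t₁ h₀ h₁ =>
    obtain ⟨hi, r₀, r₁⟩ := ht
    have hi' := Finset.mem_insert_self i S
    rw [bernMean_split i, meanDepth, ← h₀ r₀, ← h₁ r₁]
    simp only [cost, Function.update_self, if_true, Bool.false_eq_true, if_false,
      (r₀.eval_cost_update hi' _ _).2, (r₁.eval_cost_update hi' _ _).2, Nat.cast_add, Nat.cast_one,
      bernMean_add, bernMean_const]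
    ring

/-- Removes queries to coordinates already known according to `σ`, and rejects instead of making
more than `k` queries. -/
def normalize : DecisionTree n → (Fin n → Option Bool) → ℕ → DecisionTree n
  | leaf b, _, _ => leaf b
  | query i t₀ t₁, σ, k =>
    match σ i, k with
    | some b, k => if b then normalize t₁ σ k else normalize t₀ σ k
    | none, 0 => leaf false
    | none, k + 1 => query i (normalize t₀ (Function.update σ i (some false)) k)
        (normalize t₁ (Function.update σ i (some true)) k)

theorem normalize_readOnce (t : DecisionTree n) (σ : Fin n → Option Bool) (k : ℕ)
    (S : Finset (Fin n)) (hS : ∀ i ∈ S, σ i ≠ none) : ReadOnce S (normalize t σ k) := by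
  induction t generalizing σ k S with
  | leaf b => simp [normalize, ReadOnce]
  | query i t₀ t₁ h₀ h₁ =>
    unfold normalize
    have hins : ∀ b, ∀ j ∈ insert i S, Function.update σ i (some b) j ≠ none := by
      intro b j hj
      by_cases hji : j = i
      · subst hji; simp
      · rw [Function.update_of_ne hji]
        exact hS j ((Finset.mem_insert.1 hj).resolve_left hji)
    split
    · split_ifs
      · exact h₁ _ _ _ hS
      · exact h₀ _ _ _ hS
    · trivial
    · rename_i hi
      exact ⟨fun h => hS i h hi, h₀ _ _ _ (hins _), h₁ _ _ _ (hins _)⟩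

theorem cost_normalize_le (t : DecisionTree n) (σ : Fin n → Option Bool) (k : ℕ)
    (x : Fin n → Bool) : (normalize t σ k).cost x ≤ k := by
  induction t generalizing σ k with
  | leaf b => simp [normalize, cost]
  | query i t₀ t₁ h₀ h₁ =>
    unfold normalize
    split
    · split_ifs
      · exact h₁ _ _
      · exact h₀ _ _
    · simp [cost]
    · simp only [cost]
      split_ifs
      · exact Nat.add_le_add_right (h₁ _ _) 1
      · exact Nat.add_le_add_right (h₀ _ _) 1

/-- Exhausted fuel produces rejection, so the output can change only from acceptance to rejection,
and only on inputs costing more than `k`. -/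
theorem normalize_spec (t : DecisionTree n) (σ : Fin n → Option Bool) (k : ℕ)
    (x : Fin n → Bool) (hx : ∀ i b, σ i = some b → x i = b) :
    (normalize t σ k).cost x ≤ t.cost x ∧
    ((normalize t σ k).eval x = true → t.eval x = true) ∧
    (t.cost x ≤ k → (normalize t σ k).eval x = t.eval x) := by
  induction t generalizing σ k with
  | leaf b => simp [normalize, cost]
  | query i t₀ t₁ h₀ h₁ =>
    unfold normalize
    have hupd : ∀ j b, Function.update σ i (some (x i)) j = some b → x j = b := by
      intro j b hj
      by_cases hji : j = i
      · subst hji; simpa using hj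
      · rw [Function.update_of_ne hji] at hj
        exact hx j b hj
    split
    · rename_i b hi
      have hb := hx i b hi
      cases b
      · obtain ⟨p, q, r⟩ := h₀ σ _ hx
        simp only [cost, eval, hb, Bool.false_eq_true, if_false]
        exact ⟨p.trans (Nat.le_succ _), q, fun h => r (by omega)⟩
      · obtain ⟨p, q, r⟩ := h₁ σ _ hx
        simp only [cost, eval, hb, if_true]
        exact ⟨p.trans (Nat.le_succ _), q, fun h => r (by omega)⟩
    · simp [cost, eval]
    · rename_i k' hi
      cases hb : x i
      · rw [hb] at hupd
        obtain ⟨p, q, r⟩ := h₀ _ k' hupd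
        simp only [cost, eval, hb, Bool.false_eq_true, if_false]
        exact ⟨by omega, q, fun h => r (by omega)⟩
      · rw [hb] at hupd
        obtain ⟨p, q, r⟩ := h₁ _ k' hupd
        simp only [cost, eval, hb, if_true]
        exact ⟨by omega, q, fun h => r (by omega)⟩

end DecisionTree

/-! ### Real-valued expectations of bounded functions under a `PMF`. -/

section PMFMean

variable {α : Type*}

/-- The expectation of a bounded real function under a probability mass function. -/
noncomputable def pmfMean (R : PMF α) (h : α → ℝ) : ℝ := ∑' a, (R a).toReal * h a

theorem summable_pmfMean (R : PMF α) {h : α → ℝ} (hh : ∃ B, ∀ a, |h a| ≤ B) :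
    Summable fun a => (R a).toReal * h a := by
  obtain ⟨B, hB⟩ := hh
  have hs : Summable fun a => (R a).toReal := ENNReal.summable_toReal R.tsum_coe_ne_top
  refine Summable.of_norm_bounded (hs.mul_right B) fun a => ?_
  rw [norm_mul, Real.norm_of_nonneg ENNReal.toReal_nonneg]
  exact mul_le_mul_of_nonneg_left (hB a) ENNReal.toReal_nonneg

theorem pmfMean_const (R : PMF α) (c : ℝ) : pmfMean R (fun _ => c) = c := by
  have : ∑' a, (R a).toReal = 1 := by
    rw [← ENNReal.tsum_toReal_eq fun a => R.apply_ne_top a, R.tsum_coe, ENNReal.toReal_one]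
  rw [pmfMean, tsum_mul_right, this, one_mul]

theorem pmfMean_add (R : PMF α) {g h : α → ℝ} (hg : ∃ B, ∀ a, |g a| ≤ B)
    (hh : ∃ B, ∀ a, |h a| ≤ B) :
    pmfMean R (fun a => g a + h a) = pmfMean R g + pmfMean R h := by
  simp only [pmfMean, mul_add]
  exact (summable_pmfMean R hg).tsum_add (summable_pmfMean R hh)

theorem pmfMean_const_mul (R : PMF α) (c : ℝ) (h : α → ℝ) :
    pmfMean R (fun a => c * h a) = c * pmfMean R h := by
  simp only [pmfMean, ← tsum_mul_left]
  exact tsum_congr fun _ => by ring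

theorem pmfMean_mono (R : PMF α) {g h : α → ℝ} (hg : ∃ B, ∀ a, |g a| ≤ B)
    (hh : ∃ B, ∀ a, |h a| ≤ B) (hgh : ∀ a, g a ≤ h a) : pmfMean R g ≤ pmfMean R h :=
  (summable_pmfMean R hg).tsum_le_tsum
    (fun a => mul_le_mul_of_nonneg_left (hgh a) ENNReal.toReal_nonneg) (summable_pmfMean R hh)

theorem pmfMean_sum (R : PMF α) {ι : Type*} (s : Finset ι) {h : ι → α → ℝ}
    (hh : ∀ i ∈ s, ∃ B, ∀ a, |h i a| ≤ B) :
    pmfMean R (fun a => ∑ i ∈ s, h i a) = ∑ i ∈ s, pmfMean R (h i) := by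
  simp only [pmfMean, Finset.mul_sum]
  exact Summable.tsum_finsetSum fun i hi => summable_pmfMean R (hh i hi)

theorem ofReal_pmfMean (R : PMF α) {h : α → ℝ} (hh : ∃ B, ∀ a, |h a| ≤ B) (h0 : ∀ a, 0 ≤ h a) :
    ENNReal.ofReal (pmfMean R h) = ∑' a, R a * ENNReal.ofReal (h a) := by
  rw [pmfMean, ENNReal.ofReal_tsum_of_nonneg
    (fun a => mul_nonneg ENNReal.toReal_nonneg (h0 a)) (summable_pmfMean R hh)]
  exact tsum_congr fun a => by
    rw [ENNReal.ofReal_mul ENNReal.toReal_nonneg, ENNReal.ofReal_toReal (R.apply_ne_top a)]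

end PMFMean

/-! ### Clipped randomized algorithms and the contradiction from low cost. -/

namespace RandomizedAlgorithm

open DecisionTree

variable {n : ℕ}

/-- The tree with at most `M` queries, none of them repeated, that follows `D`. -/
def clip (M : ℕ) (D : DecisionTree n) : DecisionTree n := D.normalize (fun _ => none) M

theorem clip_readOnce (M : ℕ) (D : DecisionTree n) : ReadOnce ∅ (clip M D) :=
  normalize_readOnce D _ M ∅ (by simp)

theorem clip_cost_le (M : ℕ) (D : DecisionTree n) (x : Fin n → Bool) : (clip M D).cost x ≤ M :=
  cost_normalize_le D _ M x

theorem clip_spec (M : ℕ) (D : DecisionTree n) (x : Fin n → Bool) :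
    (clip M D).cost x ≤ D.cost x ∧ ((clip M D).eval x = true → D.eval x = true) ∧
    (D.cost x ≤ M → (clip M D).eval x = D.eval x) :=
  normalize_spec D _ M x (by simp)

/-- The probability that the clipped algorithm accepts `x`. -/
noncomputable def clipAccept (R : RandomizedAlgorithm n) (M : ℕ) (x : Fin n → Bool) : ℝ :=
  pmfMean R fun D => if (clip M D).eval x then 1 else 0

/-- The expected cost of the clipped algorithm on `x`. -/
noncomputable def clipCost (R : RandomizedAlgorithm n) (M : ℕ) (x : Fin n → Bool) : ℝ :=
  pmfMean R fun D => ((clip M D).cost x : ℝ)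

theorem bounded_ite (P : DecisionTree n → Prop) [DecidablePred P] :
    ∃ B : ℝ, ∀ D, |if P D then (1 : ℝ) else 0| ≤ B :=
  ⟨1, fun D => by split_ifs <;> simp⟩

theorem pmfMean_ite_nonneg (R : PMF (DecisionTree n)) (P : DecisionTree n → Prop)
    [DecidablePred P] : 0 ≤ pmfMean R fun D => if P D then (1 : ℝ) else 0 :=
  tsum_nonneg fun D => mul_nonneg ENNReal.toReal_nonneg (by dsimp only; split_ifs <;> norm_num)

theorem bounded_clip_cost (M : ℕ) (x : Fin n → Bool) :
    ∃ B : ℝ, ∀ D, |((clip M D).cost x : ℝ)| ≤ B :=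
  ⟨M, fun D => by rw [Nat.abs_cast]; exact_mod_cast clip_cost_le M D x⟩

theorem clipAccept_mem_Icc (R : RandomizedAlgorithm n) (M : ℕ) (x : Fin n → Bool) :
    clipAccept R M x ∈ Set.Icc (0 : ℝ) 1 := by
  constructor
  · exact pmfMean_ite_nonneg R _
  · rw [← pmfMean_const R 1]
    exact pmfMean_mono R (bounded_ite _) ⟨1, by simp⟩ fun D => by split_ifs <;> simp

theorem clipCost_le_fuel (R : RandomizedAlgorithm n) (M : ℕ) (x : Fin n → Bool) :
    clipCost R M x ≤ M := by
  rw [← pmfMean_const R (M : ℝ)]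
  exact pmfMean_mono R (bounded_clip_cost M x) ⟨M, by simp⟩
    fun D => by exact_mod_cast clip_cost_le M D x

theorem clipCost_le (R : RandomizedAlgorithm n) (M : ℕ) {x : Fin n → Bool} {T : ℝ} (hT : 0 ≤ T)
    (h : R.expectedCost x ≤ ENNReal.ofReal T) : clipCost R M x ≤ T := by
  rw [← ENNReal.ofReal_le_ofReal_iff hT]
  refine le_trans ?_ h
  rw [clipCost, ofReal_pmfMean R (bounded_clip_cost M x) (fun D => Nat.cast_nonneg _)]
  refine ENNReal.tsum_le_tsum fun D => ?_
  rw [ENNReal.ofReal_natCast]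
  exact mul_le_mul_right (by exact_mod_cast (clip_spec M D x).1) _

theorem outputProb_eq (R : RandomizedAlgorithm n) (x : Fin n → Bool) (b : Bool) :
    R.outputProb x b = ENNReal.ofReal (pmfMean R fun D => if D.eval x = b then 1 else 0) := by
  rw [ofReal_pmfMean R (bounded_ite _) fun D => by split_ifs <;> simp]
  refine tsum_congr fun D => ?_
  split_ifs <;> simp

theorem clipAccept_le (R : RandomizedAlgorithm n) (M : ℕ) {x : Fin n → Bool} {γ : ℝ}
    (h : ENNReal.ofReal γ ≤ R.outputProb x false) : clipAccept R M x ≤ 1 - γ := by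
  rw [outputProb_eq, ENNReal.ofReal_le_ofReal_iff] at h
  · have e : pmfMean R (fun D => (if D.eval x = false then (1 : ℝ) else 0) +
        if (clip M D).eval x then 1 else 0) ≤ 1 := by
      conv_rhs => rw [← pmfMean_const R 1]
      refine pmfMean_mono R ⟨2, fun D => ?_⟩ ⟨1, by simp⟩ fun D => ?_
      · split_ifs <;> norm_num
      · have := (clip_spec M D x).2.1
        split_ifs with h1 h2 <;> simp_all
    rw [pmfMean_add R (bounded_ite _) (bounded_ite _)] at e
    unfold clipAccept
    linarith
  · exact pmfMean_ite_nonneg R _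

/-- Only runs exceeding `M` queries can lose acceptance, and by Markov's inequality they have
probability at most `T / M`. On inputs to be rejected nothing is lost, as `clipAccept_le` shows. -/
theorem le_clipAccept (R : RandomizedAlgorithm n) {M : ℕ} (hM : 0 < M) {x : Fin n → Bool} {γ T : ℝ}
    (hT : 0 ≤ T) (hc : R.expectedCost x ≤ ENNReal.ofReal T)
    (h : ENNReal.ofReal γ ≤ R.outputProb x true) : γ - T / M ≤ clipAccept R M x := by
  have hM' : (0 : ℝ) < M := by exact_mod_cast hM
  have hb : ∃ B : ℝ, ∀ D : DecisionTree n, |min (D.cost x : ℝ) M| ≤ B :=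
    ⟨M, fun D => by rw [abs_of_nonneg (by positivity)]; exact min_le_right _ _⟩
  have hmin : pmfMean R (fun D => min (D.cost x : ℝ) M) ≤ T := by
    rw [← ENNReal.ofReal_le_ofReal_iff hT]
    refine le_trans ?_ hc
    rw [ofReal_pmfMean R hb (fun D => by positivity)]
    refine ENNReal.tsum_le_tsum fun D => mul_le_mul_right ?_ _
    rw [← ENNReal.ofReal_natCast]
    exact ENNReal.ofReal_le_ofReal (min_le_left _ _)
  rw [outputProb_eq, ENNReal.ofReal_le_ofReal_iff] at h
  · have e : pmfMean R (fun D => if D.eval x = true then (1 : ℝ) else 0) ≤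
        pmfMean R (fun D => (if (clip M D).eval x then (1 : ℝ) else 0) +
          1 / M * min (D.cost x : ℝ) M) := by
      refine pmfMean_mono R (bounded_ite _) ⟨2, fun D => ?_⟩ fun D => ?_
      · have h0 : 0 ≤ min (D.cost x : ℝ) M := by positivity
        have h1 : 1 / (M : ℝ) * min (D.cost x : ℝ) M ≤ 1 := by
          rw [one_div, ← div_eq_inv_mul, div_le_one hM']
          exact min_le_right _ _
        have h2 : 0 ≤ 1 / (M : ℝ) * min (D.cost x : ℝ) M := by positivity
        rw [abs_of_nonneg (by split_ifs <;> linarith)]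
        split_ifs <;> linarith
      · rcases le_or_gt (D.cost x) M with hle | hlt
        · rw [(clip_spec M D x).2.2 hle]
          have : 0 ≤ 1 / (M : ℝ) * min (D.cost x : ℝ) M := by positivity
          linarith
        · rw [min_eq_right (by exact_mod_cast hlt.le), one_div, inv_mul_cancel₀ hM'.ne']
          split_ifs <;> norm_num
    rw [pmfMean_add R (bounded_ite _), pmfMean_const_mul] at e
    · have : 1 / (M : ℝ) * pmfMean R (fun D => min (D.cost x : ℝ) M) ≤ T / M := by
        rw [one_div, ← div_eq_inv_mul]; gcongr
      unfold clipAccept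
      linarith
    · obtain ⟨B, hB⟩ := hb
      exact ⟨1 / M * B, fun D => by
        rw [abs_mul, abs_of_nonneg (by positivity : 0 ≤ 1 / (M : ℝ))]
        exact mul_le_mul_of_nonneg_left (hB D) (by positivity)⟩
  · exact pmfMean_ite_nonneg R _

/-- The acceptance probability of the clipped algorithm on independent bits. -/
noncomputable def meanAccept (R : RandomizedAlgorithm n) (M : ℕ) (θ : Fin n → ℝ) : ℝ :=
  bernMean θ (clipAccept R M)

/-- The expected cost of the clipped algorithm on independent bits. -/
noncomputable def meanCost (R : RandomizedAlgorithm n) (M : ℕ) (θ : Fin n → ℝ) : ℝ :=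
  bernMean θ (clipCost R M)

variable {θ θ' : Fin n → ℝ}

theorem meanAccept_eq (R : RandomizedAlgorithm n) (M : ℕ) :
    meanAccept R M θ = pmfMean R fun D => acceptProb θ (clip M D) := by
  simp only [← (clip_readOnce M _).bernMean_eval, meanAccept, bernMean, clipAccept]
  rw [pmfMean_sum]
  · exact Finset.sum_congr rfl fun x _ => (pmfMean_const_mul R _ _).symm
  · exact fun x _ => ⟨|bernWeight θ x|, fun D => by split_ifs <;> simp⟩

theorem meanCost_eq (R : RandomizedAlgorithm n) (M : ℕ) :
    meanCost R M θ = pmfMean R fun D => meanDepth θ (clip M D) := by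
  simp only [← (clip_readOnce M _).bernMean_cost, meanCost, bernMean, clipCost]
  rw [pmfMean_sum]
  · exact Finset.sum_congr rfl fun x _ => (pmfMean_const_mul R _ _).symm
  · intro x _
    obtain ⟨B, hB⟩ := bounded_clip_cost M x
    exact ⟨|bernWeight θ x| * B, fun D => by
      rw [abs_mul]; exact mul_le_mul_of_nonneg_left (hB D) (abs_nonneg _)⟩

theorem bounded_acceptProb (h : ∀ i, θ i ∈ Set.Icc (0 : ℝ) 1) (M : ℕ) :
    ∃ B : ℝ, ∀ D, |acceptProb θ (clip M D)| ≤ B :=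
  ⟨1, fun D => by
    obtain ⟨a, b⟩ := acceptProb_mem_Icc h (clip M D)
    rwa [abs_of_nonneg a]⟩

theorem bounded_meanDepth (h : ∀ i, θ i ∈ Set.Icc (0 : ℝ) 1) (M : ℕ) :
    ∃ B : ℝ, ∀ D, |meanDepth θ (clip M D)| ≤ B :=
  ⟨M, fun D => by
    rw [abs_of_nonneg (meanDepth_nonneg h _), ← (clip_readOnce M D).bernMean_cost,
      ← bernMean_const (θ := θ) (M : ℝ)]
    exact bernMean_mono h fun x _ => by exact_mod_cast clip_cost_le M D x⟩

theorem bounded_add {α : Type*} {g h : α → ℝ} (hg : ∃ B, ∀ a, |g a| ≤ B)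
    (hh : ∃ B, ∀ a, |h a| ≤ B) : ∃ B, ∀ a, |g a + h a| ≤ B := by
  obtain ⟨B, hB⟩ := hg
  obtain ⟨C, hC⟩ := hh
  exact ⟨B + C, fun a => (abs_add_le _ _).trans (add_le_add (hB a) (hC a))⟩

theorem bounded_const_mul {α : Type*} {h : α → ℝ} (c : ℝ) (hh : ∃ B, ∀ a, |h a| ≤ B) :
    ∃ B, ∀ a, |c * h a| ≤ B := by
  obtain ⟨B, hB⟩ := hh
  exact ⟨|c| * B, fun a => by
    rw [abs_mul]; exact mul_le_mul_of_nonneg_left (hB a) (abs_nonneg _)⟩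

theorem bounded_slope (A : Finset (Fin n)) (h : ∀ i, θ i ∈ Set.Icc (0 : ℝ) 1) (M k : ℕ) :
    ∃ B : ℝ, ∀ D, |slope A θ k (clip M D)| ≤ B :=
  ⟨k, fun _D => abs_slope_le h k _⟩

/-- The expected slope of the clipped algorithm. -/
noncomputable def meanSlope (R : RandomizedAlgorithm n) (M : ℕ) (A : Finset (Fin n)) (θ : Fin n → ℝ)
    (k : ℕ) : ℝ := pmfMean R fun D => slope A θ k (clip M D)

theorem meanAccept_tilt_bounds (R : RandomizedAlgorithm n) (M : ℕ) (A : Finset (Fin n))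
    (h : ∀ i, θ i ∈ Set.Icc (0 : ℝ) 1) {p : ℝ} (hp0 : 0 < p) {m : ℕ} (hm : 1 ≤ m)
    (hpm : p * m ≤ 1) :
    |meanAccept R M (tilt A θ p) - meanAccept R M (tilt A θ 0) - p * meanSlope R M A θ (m ^ 2)| ≤
      p * (5 / 4 / m * meanCost R M (tilt A θ p) + 1 / m * meanCost R M (tilt A θ 0) +
        p * (m : ℝ) ^ 4) := by
  have hm' : (1 : ℝ) ≤ m := by exact_mod_cast hm
  have tp := tilt_mem_Icc (A := A) h (p := p) ⟨hp0.le, by nlinarith⟩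
  have t0 := tilt_mem_Icc (A := A) h (p := 0) (by simp)
  have key := fun D => abs_acceptProb_tilt_sub_slope_le (A := A) h hp0 hm hpm (clip M D)
  have bp := bounded_acceptProb tp M
  have b0 := bounded_acceptProb t0 M
  have bs := bounded_slope A h M (m ^ 2)
  have cp := bounded_meanDepth tp M
  have c0 := bounded_meanDepth t0 M
  have bk : ∃ B : ℝ, ∀ _D : DecisionTree n, |p * (p * (m : ℝ) ^ 4)| ≤ B := ⟨_, fun _ => le_rfl⟩
  simp only [meanAccept_eq, meanCost_eq, meanSlope]
  have up := pmfMean_mono R bp (bounded_add (bounded_add b0 (bounded_const_mul p bs))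
    (bounded_add (bounded_add (bounded_const_mul (p * (5 / 4 / m)) cp)
      (bounded_const_mul (p * (1 / m)) c0)) bk))
    (fun D => by have := (abs_le.1 (key D)).2; linarith)
  have lo := pmfMean_mono R (bounded_add b0 (bounded_const_mul p bs))
    (bounded_add bp (bounded_add (bounded_add (bounded_const_mul (p * (5 / 4 / m)) cp)
      (bounded_const_mul (p * (1 / m)) c0)) bk))
    (fun D => by have := (abs_le.1 (key D)).1; linarith)
  rw [pmfMean_add R (bounded_add b0 (bounded_const_mul p bs))
    (bounded_add (bounded_add (bounded_const_mul _ cp) (bounded_const_mul _ c0)) bk)] at up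
  rw [pmfMean_add R bp
    (bounded_add (bounded_add (bounded_const_mul _ cp) (bounded_const_mul _ c0)) bk)] at lo
  rw [pmfMean_add R b0 (bounded_const_mul p bs),
    pmfMean_add R (bounded_add (bounded_const_mul _ cp) (bounded_const_mul _ c0)) bk,
    pmfMean_add R (bounded_const_mul _ cp) (bounded_const_mul _ c0), pmfMean_const_mul,
    pmfMean_const_mul, pmfMean_const_mul, pmfMean_const] at up lo
  rw [abs_le]
  constructor <;> linarith

/-- Transfers the slope from unflagged to flagged inputs: a bounded number of queries hardly notices
flags of rate `r`. -/
theorem meanSlope_le_meanSlope (R : RandomizedAlgorithm n) (M : ℕ) (A : Finset (Fin n))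
    (h : ∀ i, θ i ∈ Set.Icc (0 : ℝ) 1) (h' : ∀ i, θ' i ∈ Set.Icc (0 : ℝ) 1) {r : ℝ} (hr : 0 ≤ r)
    (hθ : ∀ i, |θ i - θ' i| ≤ r) (k : ℕ) :
    meanSlope R M A θ k ≤ meanSlope R M A θ' k + 2 * r * k * k := by
  have e := pmfMean_mono R (bounded_slope A h M k)
    (bounded_add (bounded_slope A h' M k) ⟨|2 * r * k * k|, fun _ => le_rfl⟩)
    (fun D => by have := (abs_le.1 (abs_slope_sub_slope_le (A := A) h h' hr hθ k (clip M D))).2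
                 linarith)
  rwa [pmfMean_add R (bounded_slope A h' M k) ⟨|2 * r * k * k|, fun _ => le_rfl⟩,
    pmfMean_const] at e

theorem sum_meanAccept_update_sub_le (R : RandomizedAlgorithm n) (M : ℕ)
    (h : ∀ i, θ i ∈ Set.Icc (0 : ℝ) 1) (J : Finset (Fin n)) :
    ∑ j ∈ J, (meanAccept R M (Function.update θ j 1) - meanAccept R M θ) ≤ meanCost R M θ := by
  have hupd : ∀ j k, Function.update θ j 1 k ∈ Set.Icc (0 : ℝ) 1 := by
    intro j k
    by_cases hk : k = j
    · subst hk; simp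
    · simpa [hk] using h k
  have bt : ∀ j, ∃ B : ℝ, ∀ D, |acceptProb (Function.update θ j 1) (clip M D) +
      (-1) * acceptProb θ (clip M D)| ≤ B := fun j =>
    bounded_add (bounded_acceptProb (hupd j) M) (bounded_const_mul (-1) (bounded_acceptProb h M))
  have e : ∀ j, meanAccept R M (Function.update θ j 1) - meanAccept R M θ =
      pmfMean R fun D => acceptProb (Function.update θ j 1) (clip M D) +
        (-1) * acceptProb θ (clip M D) := by
    intro j
    rw [pmfMean_add R (bounded_acceptProb (hupd j) M)
      (bounded_const_mul (-1) (bounded_acceptProb h M)), pmfMean_const_mul, meanAccept_eq,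
      meanAccept_eq]
    ring
  simp only [e]
  rw [← pmfMean_sum R J fun j _ => bt j, meanCost_eq]
  have hs : ∀ D, ∑ j ∈ J, (acceptProb (Function.update θ j 1) (clip M D) +
      (-1) * acceptProb θ (clip M D)) ≤ meanDepth θ (clip M D) := fun D =>
    (Finset.sum_le_sum fun j _ => by
      rw [neg_one_mul, ← sub_eq_add_neg]; exact le_abs_self _).trans
      (sum_abs_acceptProb_update_sub_le h J (clip M D))
  refine pmfMean_mono R ?_ (bounded_meanDepth h M) hs
  choose B hB using bt
  exact ⟨∑ j ∈ J, B j, fun D => (Finset.abs_sum_le_sum_abs _ _).trans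
    (Finset.sum_le_sum fun j _ => hB j D)⟩

/-- An algorithm of expected cost at most `2 * T` cannot separate the biases `0` and `40 * d` of
the bits in `A` while ignoring a bias `b` of these bits in favour of the coordinates in `J`. -/
theorem false_of_meanAccept (R : RandomizedAlgorithm n) (M : ℕ) (A J : Finset (Fin n))
    (h : ∀ i, θ i ∈ Set.Icc (0 : ℝ) 1) (h' : ∀ i, θ' i ∈ Set.Icc (0 : ℝ) 1) {d T b r : ℝ} {m : ℕ}
    (hd : 0 < d) (hT : 1 ≤ T) (hb : b = 640 * T * d) (hr : 0 ≤ r) (hθ : ∀ i, |θ i - θ' i| ≤ r)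
    (hm : 2880 * T ≤ m) (hsmall : (40 * d + 2 * r + b) * (m : ℝ) ^ 4 ≤ 1 / 320)
    (hJ : 1 ≤ d * J.card)
    (hsep : d / 2 ≤ meanAccept R M (tilt A θ (40 * d)) - meanAccept R M (tilt A θ 0))
    (hrev : ∀ j ∈ J, meanAccept R M (tilt A θ' b) ≤
      meanAccept R M (Function.update (tilt A θ' 0) j 1))
    (c₁ : meanCost R M (tilt A θ (40 * d)) ≤ 2 * T) (c₂ : meanCost R M (tilt A θ 0) ≤ 2 * T)
    (c₃ : meanCost R M (tilt A θ' b) ≤ 2 * T) (c₄ : meanCost R M (tilt A θ' 0) ≤ 2 * T) :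
    False := by
  have hm1 : (1 : ℝ) ≤ m := by linarith
  have hm0 : (0 : ℝ) < m := by linarith
  have hb0 : 0 < b := by rw [hb]; positivity
  have hm4 : (m : ℝ) ≤ (m : ℝ) ^ 4 := by
    calc (m : ℝ) = m ^ 1 := (pow_one _).symm
      _ ≤ _ := pow_le_pow_right₀ hm1 (by norm_num)
  have hdm : 0 ≤ d * (m : ℝ) ^ 4 := by positivity
  have hbm : 0 ≤ b * (m : ℝ) ^ 4 := by positivity
  have hrm : 0 ≤ r * (m : ℝ) ^ 4 := by positivity
  have p1 : 40 * d * m ≤ 1 := by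
    have := mul_le_mul_of_nonneg_left hm4 (by positivity : 0 ≤ 40 * d)
    linarith
  have p2 : b * m ≤ 1 := by
    have := mul_le_mul_of_nonneg_left hm4 hb0.le
    linarith
  have hmN : 1 ≤ m := by exact_mod_cast hm1
  have e1 := (abs_le.1 (meanAccept_tilt_bounds R M A h (by positivity : 0 < 40 * d) hmN p1)).2
  have e2 := (abs_le.1 (meanAccept_tilt_bounds R M A h' hb0 hmN p2)).1
  have e3 := meanSlope_le_meanSlope R M A h h' hr hθ (m ^ 2)
  have e4 := sum_meanAccept_update_sub_le R M
    (tilt_mem_Icc (A := A) h' (p := 0) (by simp)) J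
  -- By `hrev`, each mark lifts acceptance at least as much as the bias `b` does, while all marks
  -- together lift it by at most the expected cost.
  have e5 : (J.card : ℝ) * (meanAccept R M (tilt A θ' b) - meanAccept R M (tilt A θ' 0)) ≤
      2 * T := by
    refine le_trans ?_ (e4.trans c₄)
    rw [← nsmul_eq_mul]
    exact Finset.card_nsmul_le_sum _ _ _ fun j hj => sub_le_sub_right (hrev j hj) _
  have hTm : T / m ≤ 1 / 2880 := by
    rw [div_le_div_iff₀ hm0 (by norm_num)]; linarith
  have cost : ∀ {x y : ℝ}, x ≤ 2 * T → y ≤ 2 * T →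
      5 / 4 / (m : ℝ) * x + 1 / m * y ≤ 1 / 640 := by
    intro x y hx hy
    have h1 : 5 / 4 / (m : ℝ) * x ≤ 5 / 4 / m * (2 * T) := by gcongr
    have h2 : 1 / (m : ℝ) * y ≤ 1 / m * (2 * T) := by gcongr
    have h3 : 5 / 4 / (m : ℝ) * (2 * T) + 1 / m * (2 * T) = 9 / 2 * (T / m) := by field_simp; ring
    linarith
  have k1 := cost c₁ c₂
  have k2 := cost c₃ c₄
  push_cast at e3
  generalize meanSlope R M A θ (m ^ 2) = s at *
  generalize meanSlope R M A θ' (m ^ 2) = s' at *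
  generalize meanAccept R M (tilt A θ' b) - meanAccept R M (tilt A θ' 0) = Δ at *
  have e6 : meanAccept R M (tilt A θ (40 * d)) - meanAccept R M (tilt A θ 0) ≤
      40 * d * (s + 1 / 640 + 40 * d * (m : ℝ) ^ 4) := by
    have := mul_le_mul_of_nonneg_left (add_le_add_left k1 (40 * d * (m : ℝ) ^ 4))
      (by positivity : 0 ≤ 40 * d)
    linarith
  -- A gain of `d / 2` over a bias of `40 * d` is a slope of `1 / 80`.
  have f1 : 1 / 80 ≤ s + 1 / 640 + 40 * d * (m : ℝ) ^ 4 := by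
    by_contra hcon
    push Not at hcon
    have := mul_lt_mul_of_pos_left hcon (by positivity : 0 < 40 * d)
    linarith
  have f2 : s ≤ s' + 2 * r * (m : ℝ) ^ 4 := by
    calc s ≤ _ := e3
      _ = _ := by ring
  have f3 : b * (s' - 1 / 640 - b * (m : ℝ) ^ 4) ≤ Δ := by
    have := mul_le_mul_of_nonneg_left (add_le_add_left k2 (b * (m : ℝ) ^ 4)) hb0.le
    linarith
  -- The two cost errors `1 / 640` and the total `1 / 320` from `hsmall` consume half of the slope
  -- `1 / 80`.
  have f4 : 1 / 160 ≤ s' - 1 / 640 - b * (m : ℝ) ^ 4 := by linarith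
  have f5 : b * (1 / 160) ≤ Δ := (mul_le_mul_of_nonneg_left f4 hb0.le).trans f3
  have f6 : (J.card : ℝ) * (b * (1 / 160)) ≤ 2 * T :=
    (mul_le_mul_of_nonneg_left f5 (Nat.cast_nonneg _)).trans e5
  have f7 : (J.card : ℝ) * (b * (1 / 160)) = 4 * T * (d * J.card) := by rw [hb]; ring
  have f8 : 4 * T * 1 ≤ 4 * T * (d * J.card) := mul_le_mul_of_nonneg_left hJ (by linarith)
  linarith

end RandomizedAlgorithm

/-! ### The hard partial function and its average-case lower bound. -/

section HardFunction

variable {n : ℕ}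

/-- The coordinates from `a` up to `b`, excluding `b`. -/
def coordBlock (n a b : ℕ) : Finset (Fin n) := Finset.univ.filter fun i => a ≤ i.val ∧ i.val < b

theorem mem_coordBlock {a b : ℕ} {i : Fin n} : i ∈ coordBlock n a b ↔ a ≤ i.val ∧ i.val < b := by
  simp [coordBlock]

theorem card_coordBlock {a b : ℕ} (hb : b ≤ n) : (coordBlock n a b).card = b - a := by
  rw [← Finset.card_map Fin.valEmbedding, ← Nat.card_Ico]
  congr 1
  ext k
  simp only [Finset.mem_map, mem_coordBlock, Fin.valEmbedding_apply, Finset.mem_Ico]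
  constructor
  · rintro ⟨i, hi, rfl⟩
    exact hi
  · intro hk
    exact ⟨⟨k, by omega⟩, hk, rfl⟩

/-- The coordinates carrying signs. -/
abbrev signBlock (n N : ℕ) : Finset (Fin n) := coordBlock n 0 N

/-- The coordinates carrying flags. -/
abbrev flagBlock (n N : ℕ) : Finset (Fin n) := coordBlock n N (2 * N)

/-- The coordinates among which a mark is to be searched. -/
abbrev markBlock (n N K : ℕ) : Finset (Fin n) := coordBlock n (2 * N) (2 * N + K)

/-- The average of the signs `±1`. -/
noncomputable def signBias (N : ℕ) (x : Fin n → Bool) : ℝ :=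
  2 * (∑ i ∈ signBlock n N, if x i then (1 : ℝ) else 0) / N - 1

/-- The fraction of flags that are raised. -/
noncomputable def flagRate (N : ℕ) (x : Fin n → Bool) : ℝ :=
  (∑ i ∈ flagBlock n N, if x i then (1 : ℝ) else 0) / N

/-- Whether there is a mark. -/
def marked (N K : ℕ) (x : Fin n → Bool) : Bool := decide (∃ i ∈ markBlock n N K, x i = true)

/-- Without flags the signs are either nearly unbiased or biased towards `true`; otherwise a
constant fraction `r / 2` of the flags is raised and the bias of the signs is at most `2 * b`. -/
def hardDomain (n N : ℕ) (d r b : ℝ) : Set (Fin n → Bool) :=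
  {x | flagRate N x = 0 ∧ (signBias N x ≤ 4 * d ∨ 20 * d ≤ signBias N x) ∨
    r / 2 ≤ flagRate N x ∧ |signBias N x| ≤ 2 * b}

open Classical in
/-- Without flags the value is read off the bias of the signs, otherwise it tells whether there is a
mark. -/
noncomputable def hardFun (n N K : ℕ) (d r b : ℝ) (x : hardDomain n N d r b) : Bool :=
  if flagRate N x.1 = 0 then decide (20 * d ≤ signBias N x.1) else marked N K x.1

/-- Independent bits: flags with bias `r`, all other bits `false`. -/
noncomputable def flagBits (n N : ℕ) (r : ℝ) : Fin n → ℝ := fun i => if i ∈ flagBlock n N then r else 0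

theorem flagBits_mem_Icc {N : ℕ} {r : ℝ} (hr : r ∈ Set.Icc (0 : ℝ) 1) (i : Fin n) :
    flagBits n N r i ∈ Set.Icc (0 : ℝ) 1 := by
  unfold flagBits
  split_ifs
  · exact hr
  · simp

theorem abs_flagBits_sub_le {N : ℕ} {r : ℝ} (hr : 0 ≤ r) (i : Fin n) :
    |flagBits n N 0 i - flagBits n N r i| ≤ r := by
  unfold flagBits
  split_ifs
  · rw [zero_sub, abs_neg, abs_of_nonneg hr]
  · simpa using hr

theorem eq_of_bernWeight_ne_zero {θ : Fin n → ℝ} {x : Fin n → Bool} (hx : bernWeight θ x ≠ 0)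
    (i : Fin n) : (θ i = 0 → x i = false) ∧ (θ i = 1 → x i = true) := by
  have := Finset.prod_ne_zero_iff.1 hx i (Finset.mem_univ i)
  constructor <;> intro h <;> cases hxi : x i <;> simp_all

/-- The empirical averages of the signs or of the flags deviate by at least `d` from `θ`. -/
def Atypical (N : ℕ) (d : ℝ) (θ : Fin n → ℝ) (x : Fin n → Bool) : Prop :=
  N * d ≤ |∑ i ∈ signBlock n N, ((if x i then 1 else 0) - θ i)| ∨
    N * d ≤ |∑ i ∈ flagBlock n N, ((if x i then 1 else 0) - θ i)|

open Classical in
theorem bernMean_atypical_le {N : ℕ} (hN : 0 < N) (hn : 2 * N ≤ n) {d : ℝ} (hd : 0 < d)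
    {θ : Fin n → ℝ} (h : ∀ i, θ i ∈ Set.Icc (0 : ℝ) 1) :
    bernMean θ (fun x => if Atypical N d θ x then 1 else 0) ≤ 1 / (2 * d ^ 2 * N) := by
  have hN' : (0 : ℝ) < N := by exact_mod_cast hN
  have hs : 0 < N * d := by positivity
  have e1 := bernMean_deviation_le h (signBlock n N) hs
  have e2 := bernMean_deviation_le h (flagBlock n N) hs
  rw [card_coordBlock (by omega)] at e1 e2
  have c1 : ((N - 0 : ℕ) : ℝ) = N := by simp
  have c2 : ((2 * N - N : ℕ) : ℝ) = N := by rw [two_mul, Nat.add_sub_cancel]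
  rw [c1] at e1
  rw [c2] at e2
  have e3 : (N : ℝ) / (4 * (N * d) ^ 2) + N / (4 * (N * d) ^ 2) = 1 / (2 * d ^ 2 * N) := by
    field_simp
    norm_num
  rw [← e3]
  refine le_trans ?_ (add_le_add e1 e2)
  rw [← bernMean_add]
  refine bernMean_mono h fun x _ => ?_
  by_cases h1 : N * d ≤ |∑ i ∈ signBlock n N, ((if x i then 1 else 0) - θ i)|
  · rw [if_pos (show Atypical N d θ x from Or.inl h1), if_pos h1]
    split_ifs <;> norm_num
  · by_cases h2 : N * d ≤ |∑ i ∈ flagBlock n N, ((if x i then 1 else 0) - θ i)|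
    · rw [if_pos (show Atypical N d θ x from Or.inr h2), if_neg h1, if_pos h2, zero_add]
    · rw [if_neg (show ¬ Atypical N d θ x from not_or.2 ⟨h1, h2⟩), if_neg h1, if_neg h2, zero_add]

open RandomizedAlgorithm DecisionTree

/-- Atypical inputs may lie outside the promise, where nothing is known of the algorithm; there
acceptance is bounded by `1`. In `meanCost_le_of_typical` the cost there is bounded by `M`, which is
why trees are truncated. -/
theorem meanAccept_le_of_typical (R : RandomizedAlgorithm n) (M : ℕ) {N : ℕ} (hN : 0 < N)
    (hn : 2 * N ≤ n) {d u ε : ℝ} (hd : 0 < d) (hε : 1 / (2 * d ^ 2 * N) ≤ ε) {θ : Fin n → ℝ}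
    (h : ∀ i, θ i ∈ Set.Icc (0 : ℝ) 1) (hu : 0 ≤ u)
    (hx : ∀ x, bernWeight θ x ≠ 0 → ¬ Atypical N d θ x → clipAccept R M x ≤ u) :
    meanAccept R M θ ≤ u + ε := by
  classical
  refine le_trans ?_ (add_le_add_right ((bernMean_atypical_le hN hn hd h).trans hε) u)
  rw [← bernMean_const (θ := θ) u, ← bernMean_add]
  refine bernMean_mono h fun x hw => ?_
  split_ifs with hb
  · have := (clipAccept_mem_Icc R M x).2
    linarith [bernMean_const (θ := θ) u]
  · have := hx x hw.ne' hb
    linarith [bernMean_const (θ := θ) u]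

theorem le_meanAccept_of_typical (R : RandomizedAlgorithm n) (M : ℕ) {N : ℕ} (hN : 0 < N)
    (hn : 2 * N ≤ n) {d u ε : ℝ} (hd : 0 < d) (hε : 1 / (2 * d ^ 2 * N) ≤ ε) {θ : Fin n → ℝ}
    (h : ∀ i, θ i ∈ Set.Icc (0 : ℝ) 1) (hu : u ≤ 1)
    (hx : ∀ x, bernWeight θ x ≠ 0 → ¬ Atypical N d θ x → u ≤ clipAccept R M x) :
    u - ε ≤ meanAccept R M θ := by
  classical
  have e : u ≤ meanAccept R M θ +
      bernMean θ (fun x => if Atypical N d θ x then 1 else 0) := by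
    conv_lhs => rw [← bernMean_const (θ := θ) u]
    rw [meanAccept, ← bernMean_add]
    refine bernMean_mono h fun x hw => ?_
    split_ifs with hb
    · have := (clipAccept_mem_Icc R M x).1
      linarith
    · have := hx x hw.ne' hb
      linarith
  have := (bernMean_atypical_le hN hn hd h).trans hε
  linarith

theorem meanCost_le_of_typical (R : RandomizedAlgorithm n) (M : ℕ) {N : ℕ} (hN : 0 < N)
    (hn : 2 * N ≤ n) {d T ε : ℝ} (hd : 0 < d) (hε : 1 / (2 * d ^ 2 * N) ≤ ε) (hεM : ε * M ≤ T)
    {θ : Fin n → ℝ} (h : ∀ i, θ i ∈ Set.Icc (0 : ℝ) 1) (hT : 0 ≤ T)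
    (hx : ∀ x, bernWeight θ x ≠ 0 → ¬ Atypical N d θ x → clipCost R M x ≤ T) :
    meanCost R M θ ≤ 2 * T := by
  classical
  have e : meanCost R M θ ≤ T +
      M * bernMean θ (fun x => if Atypical N d θ x then 1 else 0) := by
    conv_rhs => rw [← bernMean_const (θ := θ) T]
    rw [meanCost, ← bernMean_const_mul, ← bernMean_add]
    refine bernMean_mono h fun x hw => ?_
    split_ifs with hb
    · have := clipCost_le_fuel R M x
      linarith
    · have := hx x hw.ne' hb
      linarith
  have := mul_le_mul_of_nonneg_left ((bernMean_atypical_le hN hn hd h).trans hε)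
    (Nat.cast_nonneg M : (0 : ℝ) ≤ M)
  linarith

/-- The averages of a typical sample from biased signs and flags of rate `r`. -/
theorem abs_sub_lt_of_typical {N : ℕ} (hN : 0 < N) (hn : 2 * N ≤ n) {d p r : ℝ} {θ : Fin n → ℝ}
    (hp : ∀ i ∈ signBlock n N, θ i = (1 + p) / 2) (hr : ∀ i ∈ flagBlock n N, θ i = r)
    {x : Fin n → Bool} (hx : ¬ Atypical N d θ x) :
    |signBias N x - p| < 2 * d ∧ |flagRate N x - r| < d := by
  have hN' : (0 : ℝ) < N := by exact_mod_cast hN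
  unfold Atypical at hx
  push Not at hx
  obtain ⟨h1, h2⟩ := hx
  rw [Finset.sum_sub_distrib, Finset.sum_congr rfl hp, Finset.sum_const,
    card_coordBlock (by omega), Nat.sub_zero, nsmul_eq_mul] at h1
  rw [Finset.sum_sub_distrib, Finset.sum_congr rfl hr, Finset.sum_const,
    card_coordBlock (by omega), two_mul, Nat.add_sub_cancel, nsmul_eq_mul] at h2
  have e1 : signBias N x - p =
      2 / N * ((∑ i ∈ signBlock n N, if x i then (1 : ℝ) else 0) - N * ((1 + p) / 2)) := by
    unfold signBias
    field_simp
    ring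
  have e2 : flagRate N x - r =
      1 / N * ((∑ i ∈ flagBlock n N, if x i then (1 : ℝ) else 0) - N * r) := by
    unfold flagRate
    field_simp
  rw [e1, e2, abs_mul, abs_mul, abs_of_pos (by positivity : 0 < 2 / (N : ℝ)),
    abs_of_pos (by positivity : 0 < 1 / (N : ℝ))]
  constructor
  · calc _ < 2 / (N : ℝ) * (N * d) := mul_lt_mul_of_pos_left h1 (by positivity)
      _ = 2 * d := by field_simp
  · calc _ < 1 / (N : ℝ) * (N * d) := mul_lt_mul_of_pos_left h2 (by positivity)
      _ = d := by field_simp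

theorem flagRate_eq_zero {N : ℕ} {θ : Fin n → ℝ} (hr : ∀ i ∈ flagBlock n N, θ i = 0)
    {x : Fin n → Bool} (hx : bernWeight θ x ≠ 0) : flagRate N x = 0 := by
  unfold flagRate
  rw [Finset.sum_eq_zero, zero_div]
  intro i hi
  simp [(eq_of_bernWeight_ne_zero hx i).1 (hr i hi)]

theorem disjoint_blocks {N K : ℕ} {i : Fin n} :
    (i ∈ flagBlock n N → i ∉ signBlock n N) ∧
    (i ∈ markBlock n N K → i ∉ signBlock n N ∧ i ∉ flagBlock n N) := by
  simp only [mem_coordBlock]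
  omega

/-- Every algorithm for the hard function with advantage `d` has expected cost more than `T` on some
input. -/
theorem not_worstExpectedCost_le {N K M m : ℕ} {d T r b : ℝ} (hN : 0 < N)
    (hM : 0 < M) (hn : 2 * N + K ≤ n)
    (hd : 0 < d) (hT : 1 ≤ T) (hb : b = 640 * T * d) (hr : r = 4 * b)
    (hm : 2880 * T ≤ m) (hsmall : (40 * d + 2 * r + b) * (m : ℝ) ^ 4 ≤ 1 / 320)
    (hKd : 1 ≤ d * K) (hε : 1 / (2 * d ^ 2 * N) ≤ d / 10) (hεM : 1 / (2 * d ^ 2 * N) * M ≤ T)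
    (hTM : T / M ≤ d / 10) (R : RandomizedAlgorithm n)
    (hs : ENNReal.ofReal ((1 + d) / 2) ≤ R.worstSuccess (hardFun n N K d r b)) :
    ¬ R.worstExpectedCost (hardDomain n N d r b) ≤ ENNReal.ofReal T := by
  intro hc
  have hT0 : 0 ≤ T := by linarith
  have hn2 : 2 * N ≤ n := by omega
  have hb0 : 0 < b := by rw [hb]; positivity
  have hbd : 640 * d ≤ b := by rw [hb]; nlinarith
  have hm1 : (1 : ℝ) ≤ m := by linarith
  have hm4 : 1 ≤ (m : ℝ) ^ 4 := one_le_pow₀ hm1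
  have hsm : 40 * d + 2 * r + b ≤ 1 / 320 := by
    have : 0 ≤ 40 * d + 2 * r + b := by linarith
    nlinarith
  have cost : ∀ x ∈ hardDomain n N d r b, clipCost R M x ≤ T := fun x hx =>
    clipCost_le R M hT0 ((le_iSup (fun y : hardDomain n N d r b => R.expectedCost y) ⟨x, hx⟩).trans hc)
  have acc : ∀ x (hx : x ∈ hardDomain n N d r b), hardFun n N K d r b ⟨x, hx⟩ = true →
      (1 + d) / 2 - d / 10 ≤ clipAccept R M x := by
    intro x hx hf
    have h1 : ENNReal.ofReal ((1 + d) / 2) ≤ R.outputProb x true := by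
      rw [← hf]
      exact hs.trans (iInf_le (fun y : hardDomain n N d r b =>
        R.outputProb y (hardFun n N K d r b y)) ⟨x, hx⟩)
    have := le_clipAccept R hM hT0
      ((le_iSup (fun y : hardDomain n N d r b => R.expectedCost y) ⟨x, hx⟩).trans hc) h1
    linarith
  have rej : ∀ x (hx : x ∈ hardDomain n N d r b), hardFun n N K d r b ⟨x, hx⟩ = false →
      clipAccept R M x ≤ (1 - d) / 2 := by
    intro x hx hf
    have h1 : ENNReal.ofReal ((1 + d) / 2) ≤ R.outputProb x false := by
      rw [← hf]
      exact hs.trans (iInf_le (fun y : hardDomain n N d r b =>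
        R.outputProb y (hardFun n N K d r b y)) ⟨x, hx⟩)
    have := clipAccept_le R M h1
    linarith
  set A := signBlock n N
  set J := markBlock n N K
  have h0 := flagBits_mem_Icc (n := n) (N := N) (r := 0) (by simp)
  have h1 := flagBits_mem_Icc (n := n) (N := N) (r := r) ⟨by linarith, by linarith⟩
  have icc : ∀ {q}, q ∈ Set.Icc (0 : ℝ) 1 → ∀ p ∈ Set.Icc (0 : ℝ) 1, ∀ i,
      tilt A (flagBits n N q) p i ∈ Set.Icc (0 : ℝ) 1 := fun hq p hp =>
    tilt_mem_Icc (flagBits_mem_Icc hq) hp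
  have hsign : ∀ q p, ∀ i ∈ signBlock n N, tilt A (flagBits n N q) p i = (1 + p) / 2 := by
    intro q p i hi
    simp only [tilt, A, if_pos hi]
  have hflag : ∀ q p, ∀ i ∈ flagBlock n N, tilt A (flagBits n N q) p i = q := by
    intro q p i hi
    simp only [tilt, A, if_neg ((disjoint_blocks (K := K)).1 hi), flagBits, if_pos hi]
  have hmark : ∀ q p, ∀ i ∈ J, tilt A (flagBits n N q) p i = 0 := by
    intro q p i hi
    simp only [tilt, A, if_neg (disjoint_blocks.2 hi).1, flagBits, if_neg (disjoint_blocks.2 hi).2]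
  -- typical inputs without flags
  have unflagged : ∀ p, ∀ x, bernWeight (tilt A (flagBits n N 0) p) x ≠ 0 →
      ¬ Atypical N d (tilt A (flagBits n N 0) p) x → flagRate N x = 0 ∧ |signBias N x - p| < 2 * d :=
    fun p x hw hx => ⟨flagRate_eq_zero (hflag 0 p) hw,
      (abs_sub_lt_of_typical hN hn2 (hsign 0 p) (hflag 0 p) hx).1⟩
  have low : ∀ x, bernWeight (tilt A (flagBits n N 0) 0) x ≠ 0 →
      ¬ Atypical N d (tilt A (flagBits n N 0) 0) x →
      ∃ hx : x ∈ hardDomain n N d r b, hardFun n N K d r b ⟨x, hx⟩ = false := by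
    intro x hw hx
    obtain ⟨e1, e2⟩ := unflagged 0 x hw hx
    have := (abs_lt.1 e2).2
    refine ⟨Or.inl ⟨e1, Or.inl (by linarith)⟩, ?_⟩
    simp only [hardFun, e1, if_true, decide_eq_false_iff_not, not_le]
    linarith
  have high : ∀ x, bernWeight (tilt A (flagBits n N 0) (40 * d)) x ≠ 0 →
      ¬ Atypical N d (tilt A (flagBits n N 0) (40 * d)) x →
      ∃ hx : x ∈ hardDomain n N d r b, hardFun n N K d r b ⟨x, hx⟩ = true := by
    intro x hw hx
    obtain ⟨e1, e2⟩ := unflagged (40 * d) x hw hx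
    have := (abs_lt.1 e2).1
    refine ⟨Or.inl ⟨e1, Or.inr (by linarith)⟩, ?_⟩
    simp only [hardFun, e1, if_true, decide_eq_true_eq]
    linarith
  -- typical inputs with flags
  have flagged : ∀ (θ : Fin n → ℝ) (p : ℝ), 0 ≤ p → p ≤ b →
      (∀ i ∈ signBlock n N, θ i = (1 + p) / 2) → (∀ i ∈ flagBlock n N, θ i = r) →
      ∀ x, ¬ Atypical N d θ x → ∃ hx : x ∈ hardDomain n N d r b,
        hardFun n N K d r b ⟨x, hx⟩ = marked N K x := by
    intro θ p hp hpb hθs hθf x hx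
    obtain ⟨e1, e2⟩ := abs_sub_lt_of_typical hN hn2 hθs hθf hx
    rw [abs_lt] at e1 e2
    have hpos : 0 < flagRate N x := by linarith
    refine ⟨Or.inr ⟨by linarith, abs_le.2 ⟨by linarith, by linarith⟩⟩, ?_⟩
    simp only [hardFun, if_neg hpos.ne']
  have unmarked : ∀ p, 0 ≤ p → p ≤ b → ∀ x, bernWeight (tilt A (flagBits n N r) p) x ≠ 0 →
      ¬ Atypical N d (tilt A (flagBits n N r) p) x →
      ∃ hx : x ∈ hardDomain n N d r b, hardFun n N K d r b ⟨x, hx⟩ = false := by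
    intro p hp hpb x hw hx
    obtain ⟨hx', e⟩ := flagged _ p hp hpb (hsign r p) (hflag r p) x hx
    refine ⟨hx', e.trans ?_⟩
    simp only [marked, decide_eq_false_iff_not, not_exists, not_and, Bool.not_eq_true]
    exact fun i hi => (eq_of_bernWeight_ne_zero hw i).1 (hmark r p i hi)
  have withMark : ∀ j ∈ J, ∀ x, bernWeight (Function.update (tilt A (flagBits n N r) 0) j 1) x ≠ 0 →
      ¬ Atypical N d (Function.update (tilt A (flagBits n N r) 0) j 1) x →
      ∃ hx : x ∈ hardDomain n N d r b, hardFun n N K d r b ⟨x, hx⟩ = true := by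
    intro j hj x hw hx
    have d' := (disjoint_blocks (n := n) (N := N) (K := K) (i := j)).2 hj
    obtain ⟨hx', e⟩ := flagged _ 0 le_rfl hb0.le
      (fun i hi => by
        rw [Function.update_of_ne (ne_of_mem_of_not_mem hi d'.1)]
        exact hsign r 0 i hi)
      (fun i hi => by
        rw [Function.update_of_ne (ne_of_mem_of_not_mem hi d'.2)]
        exact hflag r 0 i hi) x hx
    refine ⟨hx', e.trans ?_⟩
    simp only [marked, decide_eq_true_eq]
    exact ⟨j, hj, (eq_of_bernWeight_ne_zero hw j).2 (by simp)⟩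
  have p40 : 40 * d ∈ Set.Icc (0 : ℝ) 1 := ⟨by linarith, by linarith⟩
  have pb : b ∈ Set.Icc (0 : ℝ) 1 := ⟨by linarith, by linarith⟩
  have p0 : (0 : ℝ) ∈ Set.Icc (0 : ℝ) 1 := by simp
  have pr : r ∈ Set.Icc (0 : ℝ) 1 := ⟨by linarith, by linarith⟩
  -- Truncation and atypical inputs cost at most `d / 10` each. Three such losses leave `7 * d / 10`
  -- of the gap `d` between accepted and rejected inputs.
  have g1 := le_meanAccept_of_typical R M hN hn2 hd hε (icc p0 _ p40) (by linarith)
    fun x hw hx => (high x hw hx).elim fun h e => acc x h e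
  have g2 := meanAccept_le_of_typical R M hN hn2 hd hε (icc p0 _ p0) (by linarith)
    fun x hw hx => (low x hw hx).elim fun h e => rej x h e
  have g3 := meanAccept_le_of_typical R M hN hn2 hd hε (icc pr _ pb) (by linarith)
    fun x hw hx => (unmarked b hb0.le le_rfl x hw hx).elim fun h e => rej x h e
  refine false_of_meanAccept R M A J h0 h1 hd hT hb (by linarith) (abs_flagBits_sub_le (by linarith))
    hm hsmall ?_ (by linarith) ?_ ?_ ?_ ?_ ?_
  · rw [card_coordBlock hn, Nat.add_sub_cancel_left]
    exact hKd
  · intro j hj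
    have hupd : ∀ i, Function.update (tilt A (flagBits n N r) 0) j 1 i ∈ Set.Icc (0 : ℝ) 1 := by
      intro i
      by_cases hi : i = j
      · subst hi; simp
      · rw [Function.update_of_ne hi]
        exact icc pr 0 p0 i
    have g4 := le_meanAccept_of_typical R M hN hn2 hd hε hupd (by linarith)
      fun x hw hx => (withMark j hj x hw hx).elim fun h e => acc x h e
    linarith
  · exact meanCost_le_of_typical R M hN hn2 hd le_rfl hεM (icc p0 _ p40) hT0
      fun x hw hx => (high x hw hx).elim fun h _ => cost x h
  · exact meanCost_le_of_typical R M hN hn2 hd le_rfl hεM (icc p0 _ p0) hT0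
      fun x hw hx => (low x hw hx).elim fun h _ => cost x h
  · exact meanCost_le_of_typical R M hN hn2 hd le_rfl hεM (icc pr _ pb) hT0
      fun x hw hx => (unmarked b hb0.le le_rfl x hw hx).elim fun h _ => cost x h
  · exact meanCost_le_of_typical R M hN hn2 hd le_rfl hεM (icc pr _ p0) hT0
      fun x hw hx => (unmarked 0 le_rfl hb0.le x hw hx).elim fun h _ => cost x h

end HardFunction

/-! ### Finite mixtures of trees as randomized algorithms. -/

section Mixtures

open RandomizedAlgorithm DecisionTree

variable {n : ℕ}

theorem PMF.tsum_map_mul {α β : Type*} (q : PMF α) (g : α → β) (h : β → ℝ≥0∞) :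
    ∑' b, (q.map g) b * h b = ∑' a, q a * h (g a) := by
  classical
  simp only [PMF.map_apply, ← ENNReal.tsum_mul_right]
  rw [ENNReal.tsum_comm]
  refine tsum_congr fun a => ?_
  rw [tsum_eq_single (g a)]
  · simp
  · intro b hb
    simp [hb]

/-- Finite mixtures of decision trees. -/
theorem exists_mixture {ι : Type*} [Fintype ι] {w : ι → ℝ} (hw : ∀ i, 0 ≤ w i) (hw1 : ∑ i, w i = 1)
    (g : ι → DecisionTree n) :
    ∃ R : RandomizedAlgorithm n, ∀ x,
      (∀ b, R.outputProb x b = ENNReal.ofReal (∑ i, w i * if (g i).eval x = b then 1 else 0)) ∧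
      R.expectedCost x = ENNReal.ofReal (∑ i, w i * (g i).cost x) := by
  have hsum : ∑ i, ENNReal.ofReal (w i) = 1 := by
    rw [← ENNReal.ofReal_sum_of_nonneg fun i _ => hw i, hw1, ENNReal.ofReal_one]
  refine ⟨(PMF.ofFintype (fun i => ENNReal.ofReal (w i)) hsum).map g, fun x => ⟨fun b => ?_, ?_⟩⟩
  · rw [outputProb, PMF.tsum_map_mul, tsum_fintype, ENNReal.ofReal_sum_of_nonneg]
    · refine Finset.sum_congr rfl fun i _ => ?_
      rw [PMF.ofFintype_apply, ENNReal.ofReal_mul (hw i)]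
      split_ifs <;> simp
    · exact fun i _ => mul_nonneg (hw i) (by split_ifs <;> norm_num)
  · rw [expectedCost, PMF.tsum_map_mul, tsum_fintype, ENNReal.ofReal_sum_of_nonneg]
    · refine Finset.sum_congr rfl fun i _ => ?_
      rw [PMF.ofFintype_apply, ENNReal.ofReal_mul (hw i), ENNReal.ofReal_natCast]
    · exact fun i _ => mul_nonneg (hw i) (Nat.cast_nonneg _)

theorem bounded_of_finite {α : Type*} [Finite α] (h : α → ℝ) : ∃ B, ∀ a, |h a| ≤ B := by
  obtain ⟨B, hB⟩ := (Set.finite_range fun a => |h a|).bddAbove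
  exact ⟨B, fun a => hB ⟨a, rfl⟩⟩

theorem distributionalComplexity_le {X : Set (Fin n → Bool)} (f : X → Bool) {γ c : ℝ} (μ : PMF X)
    {ι : Type*} [Fintype ι] {w : ι → ℝ} (hw : ∀ i, 0 ≤ w i) (hw1 : ∑ i, w i = 1)
    (g : ι → DecisionTree n)
    (hγ : γ ≤ pmfMean μ fun x => ∑ i, w i * if (g i).eval x = f x then 1 else 0)
    (hc : pmfMean μ (fun x => ∑ i, w i * (g i).cost x) ≤ c) :
    distributionalComplexity f γ μ ≤ ENNReal.ofReal c := by
  obtain ⟨R, hR⟩ := exists_mixture hw hw1 g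
  refine (iInf₂_le R ?_).trans ?_
  · refine (ENNReal.ofReal_le_ofReal hγ).trans (le_of_eq ?_)
    rw [ofReal_pmfMean μ (bounded_of_finite _), distSuccess]
    · exact tsum_congr fun x => by rw [(hR x).1]
    · exact fun x => Finset.sum_nonneg fun i _ =>
        mul_nonneg (hw i) (by split_ifs <;> norm_num)
  · refine le_trans (le_of_eq ?_) (ENNReal.ofReal_le_ofReal hc)
    rw [ofReal_pmfMean μ (bounded_of_finite _), distCost]
    · exact tsum_congr fun x => by rw [(hR x).2]
    · exact fun x => Finset.sum_nonneg fun i _ => mul_nonneg (hw i) (Nat.cast_nonneg _)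

end Mixtures

/-! ### Cheap algorithms for the hard function against a known distribution. -/

section HardFunctionUpper

open RandomizedAlgorithm DecisionTree

variable {n : ℕ}

/-- Queries the listed coordinates until one of them is `true`. -/
def searchTree : List (Fin n) → DecisionTree n
  | [] => leaf false
  | i :: l => query i (searchTree l) (leaf true)

theorem eval_searchTree (l : List (Fin n)) (x : Fin n → Bool) :
    (searchTree l).eval x = decide (∃ i ∈ l, x i = true) := by
  induction l with
  | nil => simp [searchTree, eval]
  | cons i l ih => cases hi : x i <;> simp [searchTree, eval, ih, hi]

theorem cost_searchTree_le (l : List (Fin n)) (x : Fin n → Bool) :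
    (searchTree l).cost x ≤ l.length := by
  induction l with
  | nil => simp [searchTree, cost]
  | cons i l ih =>
    simp only [searchTree, cost, List.length_cons]
    split_ifs <;> omega

variable {N K : ℕ} {d r b : ℝ}

/-- One raised flag certifies the flagged regime, so a search for a mark then gives the right answer
with certainty. -/
theorem hardFun_of_flag (hN : 0 < N) (x : hardDomain n N d r b) {i : Fin n}
    (hi : i ∈ flagBlock n N) (hx : x.1 i = true) : hardFun n N K d r b x = marked N K x.1 := by
  have hpos : flagRate N x.1 ≠ 0 := by
    have hN' : (0 : ℝ) < N := by exact_mod_cast hN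
    refine (div_pos ?_ hN').ne'
    exact Finset.sum_pos' (fun j _ => by split_ifs <;> norm_num) ⟨i, hi, by simp [hx]⟩
  simp only [hardFun, if_neg hpos]

theorem flagRate_nonneg (x : Fin n → Bool) : 0 ≤ flagRate N x :=
  div_nonneg (Finset.sum_nonneg fun j _ => by split_ifs <;> norm_num) (Nat.cast_nonneg _)

/-- If flags are frequent, a random flag decides whether to search for a mark. -/
theorem distributionalComplexity_le_of_flags (hN : 0 < N) (hn : 2 * N + K ≤ n) (hd : 0 < d)
    (μ : PMF (hardDomain n N d r b)) (hΦ : d ≤ pmfMean μ fun x => flagRate N x.1) :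
    distributionalComplexity (hardFun n N K d r b) ((1 + d) / 2) μ ≤ ENNReal.ofReal (1 + d * K) := by
  set Φ := pmfMean μ fun x => flagRate N x.1
  have hΦ0 : 0 < Φ := hd.trans_le hΦ
  -- The probability of sampling a flag is tuned so that a raised flag is seen with average
  -- probability exactly `d`.
  set t := d / Φ
  have ht0 : 0 ≤ t := by positivity
  have ht1 : t ≤ 1 := (div_le_one hΦ0).2 hΦ
  have htΦ : t * Φ = d := div_mul_cancel₀ d hΦ0.ne'
  have hN' : (0 : ℝ) < N := by exact_mod_cast hN
  have hcard : ((flagBlock n N).card : ℝ) = N := by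
    rw [card_coordBlock (by omega), two_mul, Nat.add_sub_cancel]
  have hsum : ∀ x : Fin n → Bool,
      ∑ i ∈ flagBlock n N, (if x i then (1 : ℝ) else 0) = N * flagRate N x := by
    intro x
    unfold flagRate
    field_simp
  -- The Boolean component is a fair guess, used when no flag is sampled or the sampled flag is
  -- down; such runs succeed with probability `1 / 2`.
  let w : Bool × Option (flagBlock n N) → ℝ := fun a => match a.2 with
    | none => (1 - t) / 2
    | some _ => t / (2 * N)
  let g : Bool × Option (flagBlock n N) → DecisionTree n := fun a => match a.2 with
    | none => leaf a.1
    | some i => query i.1 (leaf a.1) (searchTree (markBlock n N K).toList)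
  have key : ∀ F : DecisionTree n → ℝ, ∑ a, w a * F (g a) =
      (1 - t) / 2 * (F (leaf true) + F (leaf false)) + t / (2 * N) * ∑ i ∈ flagBlock n N,
        (F (query i (leaf true) (searchTree (markBlock n N K).toList)) +
          F (query i (leaf false) (searchTree (markBlock n N K).toList))) := by
    intro F
    rw [Fintype.sum_prod_type, Fintype.sum_bool, Fintype.sum_option, Fintype.sum_option,
      Finset.sum_add_distrib, ← Finset.sum_coe_sort (flagBlock n N),
      ← Finset.sum_coe_sort (flagBlock n N)]
    simp only [w, g, ← Finset.mul_sum]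
    ring
  refine distributionalComplexity_le _ μ (w := w) ?_ ?_ g ?_ ?_
  · rintro ⟨c, _ | i⟩
    · simp only [w]; linarith
    · simp only [w]; positivity
  · have := key fun _ => 1
    simp only [mul_one, Finset.sum_const, nsmul_eq_mul, hcard] at this
    rw [this]
    field_simp
    ring
  · have e : ∀ x : hardDomain n N d r b,
        ∑ a, w a * (if (g a).eval x.1 = hardFun n N K d r b x then (1 : ℝ) else 0) =
        1 / 2 + t / 2 * flagRate N x.1 := by
      intro x
      rw [key fun D => if D.eval x.1 = hardFun n N K d r b x then (1 : ℝ) else 0]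
      have e1 : ∀ i ∈ flagBlock n N,
          ((if (query i (leaf true) (searchTree (markBlock n N K).toList)).eval x.1 =
              hardFun n N K d r b x then (1 : ℝ) else 0) +
            if (query i (leaf false) (searchTree (markBlock n N K).toList)).eval x.1 =
              hardFun n N K d r b x then (1 : ℝ) else 0) = 1 + if x.1 i then 1 else 0 := by
        intro i hi
        cases hx : x.1 i
        · cases hardFun n N K d r b x <;> simp [eval, hx]
        · simp only [eval, hx, if_true, hardFun_of_flag hN x hi hx, eval_searchTree,
            Finset.mem_toList, marked]
      rw [Finset.sum_congr rfl e1, Finset.sum_add_distrib, Finset.sum_const, nsmul_eq_mul, hcard,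
        hsum]
      have e2 : ((if (leaf true : DecisionTree n).eval x.1 = hardFun n N K d r b x then (1 : ℝ)
          else 0) + if (leaf false : DecisionTree n).eval x.1 = hardFun n N K d r b x then 1
          else 0) = 1 := by
        cases hardFun n N K d r b x <;> simp [eval]
      rw [e2]
      field_simp
      ring
    simp only [e]
    rw [pmfMean_add μ (bounded_of_finite _) (bounded_of_finite _), pmfMean_const, pmfMean_const_mul]
    change _ ≤ 1 / 2 + t / 2 * Φ
    linarith
  · have e : ∀ x : hardDomain n N d r b, ∑ a, w a * ((g a).cost x.1 : ℝ) ≤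
        t + t * K * flagRate N x.1 := by
      intro x
      rw [key fun D => (D.cost x.1 : ℝ)]
      have e1 : ∀ i ∈ flagBlock n N, ∀ c,
          ((query i (leaf c) (searchTree (markBlock n N K).toList)).cost x.1 : ℝ) ≤
            1 + K * if x.1 i then 1 else 0 := by
        intro i _ c
        cases hx : x.1 i
        · simp [cost, hx]
        · have h1 := cost_searchTree_le (markBlock n N K).toList x.1
          rw [Finset.length_toList, card_coordBlock hn, Nat.add_sub_cancel_left] at h1
          have h2 : ((searchTree (markBlock n N K).toList).cost x.1 : ℝ) ≤ K := by exact_mod_cast h1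
          simp only [cost, hx, if_true, Nat.cast_add, Nat.cast_one, mul_one]
          linarith
      have e2 := Finset.sum_le_sum fun i hi => add_le_add (e1 i hi true) (e1 i hi false)
      simp only [Finset.sum_add_distrib, ← Finset.mul_sum, Finset.sum_const, nsmul_eq_mul, hcard,
        hsum] at e2
      rw [Finset.sum_add_distrib]
      have e3 := mul_le_mul_of_nonneg_left e2 (by positivity : 0 ≤ t / (2 * (N : ℝ)))
      simp only [cost, Nat.cast_zero, add_zero, mul_zero, zero_add] at e3 ⊢
      refine e3.trans (le_of_eq ?_)
      field_simp
      ring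
    refine (pmfMean_mono μ (bounded_of_finite _) (bounded_of_finite _) e).trans ?_
    rw [pmfMean_add μ (bounded_of_finite _) (bounded_of_finite _), pmfMean_const, pmfMean_const_mul]
    change t + t * K * Φ ≤ _
    have : t * K * Φ = d * K := by rw [← htΦ]; ring
    linarith

/-- If flags are rare, a random sign or a constant suffices. -/
theorem distributionalComplexity_le_of_no_flags (hN : 0 < N) (hn : 2 * N + K ≤ n) (hd : 0 < d)
    (hd1 : d ≤ 1 / 4) (hr : r = 4 * b) (hdr : 16 * d ≤ r)
    (μ : PMF (hardDomain n N d r b)) (hΦ : pmfMean μ (fun x => flagRate N x.1) ≤ d) :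
    distributionalComplexity (hardFun n N K d r b) ((1 + d) / 2) μ ≤ ENNReal.ofReal 1 := by
  classical
  have hN' : (0 : ℝ) < N := by exact_mod_cast hN
  have hr0 : 0 < r := by linarith
  let P : hardDomain n N d r b → ℝ := fun x =>
    if flagRate N x.1 = 0 ∧ hardFun n N K d r b x = true then 1 else 0
  have hcard : ((signBlock n N).card : ℝ) = N := by
    rw [card_coordBlock (by omega), Nat.sub_zero]
  have fin := fun h : hardDomain n N d r b → ℝ => bounded_of_finite h
  -- `P` indicates unflagged inputs of value `true`. If they carry mass at least `1 / 4`, a random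
  -- sign is output, otherwise the constant `false`.
  rcases le_or_gt (1 / 4) (pmfMean μ P) with hP | hP
  · refine distributionalComplexity_le _ μ (w := fun _ : signBlock n N => 1 / N) (fun _ => by positivity)
      ?_ (fun i => query i.1 (leaf false) (leaf true)) ?_ ?_
    · rw [Finset.sum_const, Finset.card_univ, Fintype.card_coe, nsmul_eq_mul, hcard]
      field_simp
    · have e : ∀ x : hardDomain n N d r b, 1 / 2 + 12 * d * P x + (-2 * d + -1 / 2 * flagRate N x.1) ≤
          ∑ i : signBlock n N, 1 / (N : ℝ) *
            if (query i.1 (leaf false) (leaf true)).eval x.1 = hardFun n N K d r b x then 1 else 0 := by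
        intro x
        have hsum : ∑ i ∈ signBlock n N, (if x.1 i then (1 : ℝ) else 0) =
            N * ((1 + signBias N x.1) / 2) := by
          unfold signBias
          field_simp
          ring
        rw [← Finset.mul_sum, Finset.sum_coe_sort (signBlock n N) fun i =>
          if (query i (leaf false) (leaf true)).eval x.1 = hardFun n N K d r b x then (1 : ℝ) else 0]
        have e1 : ∑ i ∈ signBlock n N,
            (if (query i (leaf false) (leaf true)).eval x.1 = hardFun n N K d r b x
              then (1 : ℝ) else 0) =
            if hardFun n N K d r b x = true then N * ((1 + signBias N x.1) / 2)
            else N * ((1 - signBias N x.1) / 2) := by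
          cases hardFun n N K d r b x
          · have : ∀ i ∈ signBlock n N,
                (if (query i (leaf false) (leaf true)).eval x.1 = false then (1 : ℝ) else 0) =
                1 - if x.1 i then 1 else 0 := by
              intro i _
              cases hx : x.1 i <;> simp [eval, hx]
            rw [Finset.sum_congr rfl this, Finset.sum_sub_distrib, Finset.sum_const, nsmul_eq_mul,
              hcard, hsum]
            simp only [Bool.false_eq_true, if_false]
            ring
          · rw [← hsum]
            simp only [if_true]
            refine Finset.sum_congr rfl fun i _ => ?_
            cases hx : x.1 i <;> simp [eval, hx]
        have e2 : 1 / (N : ℝ) * (if hardFun n N K d r b x = true then N * ((1 + signBias N x.1) / 2)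
            else N * ((1 - signBias N x.1) / 2)) = if hardFun n N K d r b x = true then
            (1 + signBias N x.1) / 2 else (1 - signBias N x.1) / 2 := by
          split_ifs <;> field_simp
        rw [e1, e2]
        have hrate := flagRate_nonneg (N := N) x.1
        rcases x.2 with ⟨h0, hb⟩ | ⟨h1, h2⟩
        · rw [h0]
          by_cases h20 : 20 * d ≤ signBias N x.1
          · have hf : hardFun n N K d r b x = true := by simp [hardFun, h0, h20]
            simp only [P, hf, h0, and_self, if_true]
            linarith
          · have hf : hardFun n N K d r b x = false := by simp [hardFun, h0, h20]
            have := hb.resolve_right h20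
            simp only [P, hf, h0, Bool.false_eq_true, and_false, if_false]
            linarith
        · have h0 : flagRate N x.1 ≠ 0 := by
            have : 0 < flagRate N x.1 := by linarith
            exact this.ne'
          simp only [P, h0, false_and, if_false]
          rw [abs_le] at h2
          split_ifs <;> linarith
      refine le_trans ?_ (pmfMean_mono μ (fin _) (fin _) e)
      rw [pmfMean_add μ (fin _) (fin _), pmfMean_add μ (fin _) (fin _),
        pmfMean_add μ (fin _) (fin _), pmfMean_const, pmfMean_const, pmfMean_const_mul,
        pmfMean_const_mul]
      have := mul_le_mul_of_nonneg_left hP hd.le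
      linarith
    · have e : ∀ x : hardDomain n N d r b, ∑ i : signBlock n N, 1 / (N : ℝ) *
          ((query i.1 (leaf false) (leaf true)).cost x.1 : ℝ) = 1 := by
        intro x
        simp only [cost, ite_self, zero_add, Nat.cast_one, mul_one]
        rw [Finset.sum_const, Finset.card_univ, Fintype.card_coe, nsmul_eq_mul, hcard]
        field_simp
      simp only [e, pmfMean_const, le_refl]
  · refine distributionalComplexity_le _ μ (w := fun _ : Unit => 1) (fun _ => by norm_num)
      (by simp) (fun _ => leaf false) ?_ ?_
    · have e : ∀ x : hardDomain n N d r b, 1 + -1 * P x + -(2 / r) * flagRate N x.1 ≤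
          ∑ _i : Unit, (1 : ℝ) *
            if (leaf false : DecisionTree n).eval x.1 = hardFun n N K d r b x then 1 else 0 := by
        intro x
        simp only [Finset.univ_unique, Finset.sum_singleton, one_mul, eval]
        rcases x.2 with ⟨h0, hb⟩ | ⟨h1, h2⟩
        · cases hf : hardFun n N K d r b x <;> simp [P, h0, hf]
        · have : 1 ≤ 2 / r * flagRate N x.1 := by
            rw [div_mul_eq_mul_div, le_div_iff₀ hr0]
            linarith
          have h3 : -(2 / r) * flagRate N x.1 ≤ -1 := by
            rw [neg_mul]; linarith
          have h4 : 0 ≤ P x := by simp only [P]; split_ifs <;> norm_num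
          refine le_trans (by linarith : _ ≤ (0 : ℝ)) ?_
          cases hardFun n N K d r b x <;> simp
      refine le_trans ?_ (pmfMean_mono μ (fin _) (fin _) e)
      rw [pmfMean_add μ (fin _) (fin _), pmfMean_add μ (fin _) (fin _), pmfMean_const,
        pmfMean_const_mul, pmfMean_const_mul]
      have h1 : -(2 / r) * d ≤ -(2 / r) * pmfMean μ (fun x => flagRate N x.1) :=
        mul_le_mul_of_nonpos_left hΦ (neg_nonpos.2 (by positivity))
      have h2 : 2 / r * d ≤ 1 / 8 := by
        rw [div_mul_eq_mul_div, div_le_iff₀ hr0]; linarith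
      linarith
    · have e : ∀ x : hardDomain n N d r b, ∑ _i : Unit, (1 : ℝ) *
          ((leaf false : DecisionTree n).cost x.1 : ℝ) = 0 := by
        intro x
        simp [cost]
      simp only [e, pmfMean_const]
      norm_num

theorem maxDistributionalComplexity_hardFun_le (hN : 0 < N) (hn : 2 * N + K ≤ n) (hd : 0 < d)
    (hd1 : d ≤ 1 / 4) (hr : r = 4 * b) (hdr : 16 * d ≤ r) :
    maxDistributionalComplexity (hardFun n N K d r b) ((1 + d) / 2) ≤
      ENNReal.ofReal (1 + d * K) := by
  refine iSup_le fun μ => ?_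
  rcases le_total d (pmfMean μ fun x => flagRate N x.1) with h | h
  · exact distributionalComplexity_le_of_flags hN hn hd μ h
  · refine (distributionalComplexity_le_of_no_flags hN hn hd hd1 hr hdr μ h).trans
      (ENNReal.ofReal_le_ofReal ?_)
    have : 0 ≤ d * K := by positivity
    linarith

theorem hardFun_surjective (hN : 0 < N) (hn : 2 * N + K ≤ n) (hd : 0 < d) (hd1 : d ≤ 1 / 20) :
    Function.Surjective (hardFun n N K d r b) := by
  have hN' : (0 : ℝ) < N := by exact_mod_cast hN
  intro c
  cases c
  · have h0 : flagRate N (fun _ : Fin n => false) = 0 := by simp [flagRate]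
    have h1 : signBias N (fun _ : Fin n => false) = -1 := by simp [signBias]
    refine ⟨⟨fun _ => false, Or.inl ⟨h0, Or.inl (by rw [h1]; linarith)⟩⟩, ?_⟩
    simp only [hardFun, h0, h1, if_true, decide_eq_false_iff_not]
    linarith
  · set x : Fin n → Bool := fun i => decide (i ∈ signBlock n N)
    have h0 : flagRate N x = 0 := by
      unfold flagRate
      rw [Finset.sum_eq_zero, zero_div]
      intro i hi
      simp only [x, decide_eq_true_eq, if_neg ((disjoint_blocks (K := K)).1 hi)]
    have h1 : signBias N x = 1 := by
      unfold signBias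
      have : ∀ i ∈ signBlock n N, (if x i then (1 : ℝ) else 0) = 1 := by
        intro i hi
        simp only [x, hi, decide_true, if_true]
      rw [Finset.sum_congr rfl this, Finset.sum_const, card_coordBlock (by omega), nsmul_eq_mul,
        Nat.sub_zero]
      field_simp
      norm_num
    refine ⟨⟨x, Or.inl ⟨h0, Or.inr (by rw [h1]; linarith)⟩⟩, ?_⟩
    simp only [hardFun, h0, h1, if_true, decide_eq_true_eq]
    linarith

end HardFunctionUpper

/-! ### Choice of parameters, and the dictator for large advantages. -/

section Separation

open RandomizedAlgorithm DecisionTree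

/-- The hard function has large average-case complexity. -/
theorem le_averageCaseComplexity_hardFun {n N K M m : ℕ} {d T r b : ℝ} (hN : 0 < N)
    (hM : 0 < M) (hn : 2 * N + K ≤ n) (hd : 0 < d) (hT : 1 ≤ T) (hb : b = 640 * T * d)
    (hr : r = 4 * b) (hm : 2880 * T ≤ m) (hsmall : (40 * d + 2 * r + b) * (m : ℝ) ^ 4 ≤ 1 / 320)
    (hKd : 1 ≤ d * K) (hε : 1 / (2 * d ^ 2 * N) ≤ d / 10) (hεM : 1 / (2 * d ^ 2 * N) * M ≤ T)
    (hTM : T / M ≤ d / 10) :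
    ENNReal.ofReal T ≤ averageCaseComplexity (hardFun n N K d r b) ((1 + d) / 2) :=
  le_iInf₂ fun R hs => (not_le.1 (not_worstExpectedCost_le hN hM hn hd hT hb hr hm hsmall hKd
    hε hεM hTM R hs)).le

theorem maxDistributionalComplexity_dictator_le {n : ℕ} (i : Fin n) {γ : ℝ} (hγ : γ ≤ 1) :
    maxDistributionalComplexity (fun x : (Set.univ : Set (Fin n → Bool)) => x.1 i) γ ≤ 1 := by
  refine iSup_le fun μ => ?_
  rw [← ENNReal.ofReal_one]
  refine distributionalComplexity_le _ μ (w := fun _ : Unit => 1) (fun _ => by norm_num)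
    (by simp) (fun _ => query i (leaf false) (leaf true)) ?_ ?_
  · refine hγ.trans (le_of_eq ?_)
    conv_lhs => rw [← pmfMean_const μ 1]
    congr 1
    ext x
    cases hx : x.1 i <;> simp [eval, hx]
  · refine le_of_eq ?_
    conv_rhs => rw [← pmfMean_const μ 1]
    congr 1
    ext x
    simp [cost]

/-- A tree making no query is right on exactly one of the two constant inputs. The success
probabilities there sum to at least `1 + d`, so with probability at least `d` some query is made. -/
theorem le_averageCaseComplexity_dictator {n : ℕ} (i : Fin n) (d : ℝ) :
    ENNReal.ofReal d ≤ averageCaseComplexity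
      (fun x : (Set.univ : Set (Fin n → Bool)) => x.1 i) ((1 + d) / 2) := by
  refine le_iInf₂ fun R hs => ?_
  set x : Fin n → Bool := fun _ => false
  set y : Fin n → Bool := fun _ => true
  have nonneg : ∀ z c, 0 ≤ pmfMean R fun D => if D.eval z = c then (1 : ℝ) else 0 := fun z c =>
    pmfMean_ite_nonneg R _
  have hx : (1 + d) / 2 ≤ pmfMean R fun D => if D.eval x = false then 1 else 0 := by
    rw [← ENNReal.ofReal_le_ofReal_iff (nonneg _ _), ← outputProb_eq]
    exact hs.trans (iInf_le _ (⟨x, trivial⟩ : (Set.univ : Set (Fin n → Bool))))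
  have hy : (1 + d) / 2 ≤ pmfMean R fun D => if D.eval y = true then 1 else 0 := by
    rw [← ENNReal.ofReal_le_ofReal_iff (nonneg _ _), ← outputProb_eq]
    exact hs.trans (iInf_le _ (⟨y, trivial⟩ : (Set.univ : Set (Fin n → Bool))))
  have bmin : ∃ B : ℝ, ∀ D : DecisionTree n, |min (D.cost x : ℝ) 1| ≤ B :=
    ⟨1, fun D => by rw [abs_of_nonneg (by positivity)]; exact min_le_right _ _⟩
  have key := pmfMean_mono R (bounded_add (bounded_ite fun D => D.eval x = false)
    (bounded_ite fun D => D.eval y = true))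
    (bounded_add ⟨1, fun _ => by simp⟩ bmin)
    (h := fun D => 1 + min (D.cost x : ℝ) 1) (fun D => by
      cases D with
      | leaf c => cases c <;> simp [eval, cost]
      | query j t₀ t₁ =>
        rw [min_eq_right]
        · split_ifs <;> norm_num
        · simp [cost])
  rw [pmfMean_add R (bounded_ite _) (bounded_ite _), pmfMean_add R ⟨1, fun _ => by simp⟩ bmin,
    pmfMean_const] at key
  have h1 : d ≤ pmfMean R fun D => min (D.cost x : ℝ) 1 := by linarith
  refine (ENNReal.ofReal_le_ofReal h1).trans ?_
  rw [ofReal_pmfMean R bmin fun D => by positivity]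
  refine le_trans ?_ (le_iSup (fun z : (Set.univ : Set (Fin n → Bool)) => R.expectedCost z)
    ⟨x, trivial⟩)
  refine ENNReal.tsum_le_tsum fun D => mul_le_mul_right ?_ _
  rw [← ENNReal.ofReal_natCast]
  exact ENNReal.ofReal_le_ofReal (min_le_left _ _)

/-- The separation for advantages `d = t⁻⁶` that are small and at least an inverse power of `n`. -/
theorem exists_separation {n : ℕ} {d t : ℝ} (ht : 10 ^ 21 ≤ t) (hdt : d * t ^ 6 = 1)
    (hn : t ^ 60 ≤ n) :
    ∃ (X : Set (Fin n → Bool)) (f : X → Bool), Function.Surjective f ∧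
      maxDistributionalComplexity f ((1 + d) / 2) ≤ ENNReal.ofReal 3 ∧
      ENNReal.ofReal t ≤ averageCaseComplexity f ((1 + d) / 2) := by
  have ht1 : 1 ≤ t := le_trans (by norm_num) ht
  have ht0 : 0 < t := by linarith
  have hd : d = 1 / t ^ 6 := by field_simp; exact hdt
  have hd0 : 0 < d := by rw [hd]; positivity
  have pow1 : ∀ k : ℕ, 1 ≤ t ^ k := fun k => one_le_pow₀ ht1
  have hd1 : d ≤ 1 / 20 := by
    rw [hd, div_le_div_iff₀ (by positivity) (by norm_num)]
    have : t ^ 1 ≤ t ^ 6 := pow_le_pow_right₀ ht1 (by norm_num)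
    linarith
  -- `K` is about `1 / d`; `M` makes the truncation loss `t / M` at most `d / 10`; `N` bounds the
  -- atypical mass by `1 / (2 * t ^ 18)`, small even after multiplication by `M`; and `m` is of the
  -- order of the cost bound `T = t`.
  set N := ⌈t ^ 30⌉₊
  set K := ⌈t ^ 6⌉₊
  set M := ⌈10 * t ^ 7⌉₊
  set m := ⌈2880 * t⌉₊
  have N1 : t ^ 30 ≤ N := Nat.le_ceil _
  have N2 : (N : ℝ) ≤ t ^ 30 + 1 := (Nat.ceil_lt_add_one (by positivity)).le
  have K1 : t ^ 6 ≤ K := Nat.le_ceil _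
  have K2 : (K : ℝ) ≤ t ^ 6 + 1 := (Nat.ceil_lt_add_one (by positivity)).le
  have M1 : 10 * t ^ 7 ≤ M := Nat.le_ceil _
  have M2 : (M : ℝ) ≤ 10 * t ^ 7 + 1 := (Nat.ceil_lt_add_one (by positivity)).le
  have m1 : 2880 * t ≤ m := Nat.le_ceil _
  have m2 : (m : ℝ) ≤ 2881 * t := by
    have := (Nat.ceil_lt_add_one (by positivity : 0 ≤ 2880 * t)).le
    linarith
  have hN : 0 < N := Nat.ceil_pos.2 (by positivity)
  have hM : 0 < M := Nat.ceil_pos.2 (by positivity)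
  have hNK : 2 * N + K ≤ n := by
    have e1 : t ^ 6 ≤ t ^ 30 := pow_le_pow_right₀ ht1 (by norm_num)
    have e2 : t ^ 60 = t ^ 30 * t ^ 30 := by rw [← pow_add]
    have e3 : t ^ 1 ≤ t ^ 30 := pow_le_pow_right₀ ht1 (by norm_num)
    have e4 : 6 ≤ t ^ 30 := by linarith
    have : (2 * N + K : ℝ) ≤ n := by nlinarith [pow1 30]
    exact_mod_cast this
  have hKd : d * K ≤ 2 := by
    calc d * K ≤ d * (t ^ 6 + 1) := by gcongr
      _ = 1 + d := by rw [mul_add, hdt, mul_one]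
      _ ≤ 2 := by linarith
  have hε : 1 / (2 * d ^ 2 * N) ≤ 1 / (2 * t ^ 18) := by
    rw [div_le_div_iff₀ (by positivity) (by positivity), hd]
    have : 1 * (2 * t ^ 18) = 2 * (1 / t ^ 6) ^ 2 * t ^ 30 := by field_simp
    rw [this, one_mul]
    gcongr
  have hb0 : (0 : ℝ) ≤ 640 * t * d := by positivity
  refine ⟨hardDomain n N d (4 * (640 * t * d)) (640 * t * d), hardFun n N K d _ _,
    hardFun_surjective hN hNK hd0 hd1, ?_, ?_⟩
  · refine (maxDistributionalComplexity_hardFun_le hN hNK hd0 (by linarith) rfl ?_).trans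
      (ENNReal.ofReal_le_ofReal (by linarith))
    nlinarith
  · refine le_averageCaseComplexity_hardFun (M := M) (m := m) hN hM hNK hd0 ht1 rfl rfl m1 ?_ ?_ ?_
      ?_ ?_
    -- This condition fixes the scale: its left side is of order `t ^ 5 * d = 1 / t`, and the
    -- threshold `10 ^ 21` exceeds the constant `320 * 5800 * 2881 ^ 4`.
    · have e1 : 40 * d + 2 * (4 * (640 * t * d)) + 640 * t * d ≤ 5800 / t ^ 5 := by
        have e : 5800 / t ^ 5 = 5800 * t * d := by rw [hd]; field_simp
        rw [e]
        nlinarith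
      calc (40 * d + 2 * (4 * (640 * t * d)) + 640 * t * d) * (m : ℝ) ^ 4
          ≤ 5800 / t ^ 5 * (2881 * t) ^ 4 := by gcongr
        _ = 5800 * 2881 ^ 4 / t := by field_simp
        _ ≤ 1 / 320 := by
          rw [div_le_div_iff₀ ht0 (by norm_num)]
          linarith
    · rw [← hdt]
      gcongr
    · refine hε.trans ?_
      rw [hd, div_div, div_le_div_iff₀ (by positivity) (by positivity)]
      have e1 : t ^ 18 = t ^ 6 * t ^ 12 := by rw [← pow_add]
      have e2 : t ^ 1 ≤ t ^ 12 := pow_le_pow_right₀ ht1 (by norm_num)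
      have e3 : t ^ 6 * 5 ≤ t ^ 6 * t ^ 12 := by gcongr; linarith
      linarith
    · have e1 : 1 / (2 * d ^ 2 * N) * M ≤ 1 / (2 * t ^ 18) * (10 * t ^ 7 + 1) := by gcongr
      refine e1.trans ?_
      rw [div_mul_eq_mul_div, div_le_iff₀ (by positivity)]
      have e2 : t * (2 * t ^ 18) = 2 * (t ^ 7 * t ^ 12) := by ring
      have e3 : t ^ 1 ≤ t ^ 12 := pow_le_pow_right₀ ht1 (by norm_num)
      have e4 : t ^ 7 * 6 ≤ t ^ 7 * t ^ 12 := by gcongr; linarith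
      have := pow1 7
      linarith
    · rw [div_le_iff₀ (by exact_mod_cast hM)]
      calc t = d / 10 * (10 * t ^ 7) := by rw [hd]; field_simp
        _ ≤ _ := by gcongr

end Separation

theorem mainTheorem10 :
    ∃ C c : ℝ, 0 < C ∧ 0 < c ∧
      ∀ n : ℕ, 1 ≤ n → ∀ δ : ℝ, (n : ℝ) ^ (-c) ≤ δ → δ ≤ 1 →
        ∃ (X : Set (Fin n → Bool)) (f : X → Bool),
          Function.Surjective f ∧
          maxDistributionalComplexity f ((1 + δ) / 2) ≤
            ENNReal.ofReal (C * δ ^ (1 / 6 : ℝ)) * averageCaseComplexity f ((1 + δ) / 2) := by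
  -- With `t = δ ^ (-1 / 6)`, the exponent `1 / 10` gives `t ^ 60 = δ ^ (-10) ≤ n`, ample room for
  -- the blocks. The constant is set by the dictator case.
  refine ⟨(10 ^ 21) ^ 12, 1 / 10, by positivity, by norm_num, fun n hn δ hδ hδ1 => ?_⟩
  have hn0 : (0 : ℝ) < n := by exact_mod_cast hn
  have hδ0 : 0 < δ := (Real.rpow_pos_of_pos hn0 _).trans_le hδ
  set s := δ ^ (1 / 6 : ℝ)
  have hs0 : 0 < s := Real.rpow_pos_of_pos hδ0 _
  have hs6 : s ^ 6 = δ := by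
    rw [← Real.rpow_natCast, ← Real.rpow_mul hδ0.le]
    norm_num
  rcases le_or_gt s (1 / 10 ^ 21) with hs | hs
  · have hn60 : s⁻¹ ^ 60 ≤ n := by
      have h1 : ((n : ℝ) ^ (-(1 / 10) : ℝ)) ^ 10 ≤ δ ^ 10 := by gcongr
      rw [← Real.rpow_natCast, ← Real.rpow_mul hn0.le] at h1
      norm_num at h1
      rw [Real.rpow_neg_one] at h1
      have h2 : s⁻¹ ^ 60 = (δ ^ 10)⁻¹ := by rw [← hs6, inv_pow, ← pow_mul]
      rw [h2]
      exact inv_le_of_inv_le₀ hn0 h1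
    obtain ⟨X, f, hf, hmax, havg⟩ := exists_separation (n := n) (d := δ) (t := s⁻¹)
      (by rw [le_inv_comm₀ (by positivity) hs0, ← one_div]; exact hs)
      (by rw [← hs6, inv_pow]; exact mul_inv_cancel₀ (by positivity)) hn60
    refine ⟨X, f, hf, hmax.trans ?_⟩
    refine le_trans ?_ (mul_le_mul_right havg _)
    rw [← ENNReal.ofReal_mul (by positivity)]
    refine ENNReal.ofReal_le_ofReal ?_
    rw [mul_assoc, mul_inv_cancel₀ hs0.ne']
    norm_num
  -- Here `s > 10 ^ (-21)`. The maximum distributional complexity is at most `1` and the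
  -- average-case complexity at least `δ = s ^ 6`, so `1 ≤ C * s ^ 7` is needed; it follows from `1
  -- ≤ C * s ^ 12` because `s ≤ 1`.
  · set i : Fin n := ⟨0, hn⟩
    refine ⟨Set.univ, fun x => x.1 i, fun c => ⟨⟨fun _ => c, trivial⟩, rfl⟩, ?_⟩
    refine (maxDistributionalComplexity_dictator_le i (by linarith)).trans ?_
    refine le_trans ?_ (mul_le_mul_right (le_averageCaseComplexity_dictator i δ) _)
    rw [← ENNReal.ofReal_mul (by positivity), ← ENNReal.ofReal_one]
    refine ENNReal.ofReal_le_ofReal ?_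
    have hs1 : s ≤ 1 := Real.rpow_le_one hδ0.le hδ1 (by norm_num)
    have h1 : s ^ 12 ≤ s * δ := by
      rw [← hs6, ← pow_succ']
      exact pow_le_pow_of_le_one hs0.le hs1 (by norm_num)
    have h2 : 1 ≤ (10 ^ 21 * s) ^ 12 := by
      refine one_le_pow₀ ?_
      rw [div_lt_iff₀ (by positivity)] at hs
      linarith
    rw [mul_pow] at h2
    rw [mul_assoc]
    exact h2.trans (mul_le_mul_of_nonneg_left h1 (by positivity))
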